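/- Let $q\in\mathbb{C}^\times$ be generic, i.e. not a root of unity, with $\delta:=q+q^{-1}$ real and $\delta\ge 0$. Let $TL_n=TL_n(\delta)$ be the Temperley–Lieb algebra: the unital $\mathbb{C}$-algebra with generators $e_1,\dots,e_{n-1}$ and relations $e_i^2=\delta e_i$, $e_ie_{i\pm1}e_i=e_i$, and $e_ie_j=e_je_i$ for $|i-j|>1$. Let $TL_\infty=\bigcup_n TL_n$, with the conjugate-linear involution $*$ that reverses products and satisfies $e_i^*=e_i$. For $0\le p\le\lfloor n/2\rfloor$ let $\mathcal V_{n,p}$ be the standard representation of $TL_n$: its basis consists of the non-crossing link states on $n$ points with $p$ cups and $n-2p$ through strands, and $TL_n$ acts by concatenation (a closed loop gives a factor $\delta$, and a result with more than $p$ cups is set to $0$). Let $t_{n,p}$ be its matrix trace, so $t_{n,p}(1)=\dim\mathcal V_{n,p}$. A trace on $TL_\infty$ is a linear functional $t:TL_\infty\to\mathbb{C}$ with $t(ab)=t(ba)$; it is normalized if $t(1)=1$. Given a set $S$ of normalized traces, an element of $S$ is extremal in $S$ if it is not a proper convex combination of two different elements of $S$. For $r\in\mathbb{C}^\times$ let $[0]_r=0$,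 $[1]_r=1$, $[n]_r=(r+r^{-1})[n-1]_r-[n-2]_r$; thus $[n]_r=\frac{r^n-r^{-n}}{r-r^{-1}}$ if $r\neq\pm1$. (a) For each trace $t$ on $TL_\infty$ there are unique numbers $c_{n,i}\in\mathbb{C}$ ($n\ge0$, $0\le i\le\lfloor n/2\rfloor$), the coefficients of $t$, such that $t|_{TL_n}=\sum_{i=0}^{\lfloor n/2\rfloor}c_{n,i}\,t_{n,i}$ for every $n$. (b) Let $S$ be the set of normalized traces with positive coefficients, i.e. $c_{n,i}>0$ for all $n,i$. The extremal elements of $S$ form a one-parameter family $(t_\gamma)_{0<\gamma\le 1/4}$, in which different values of $\gamma$ give different traces. For every $0<\gamma\le\frac14$ there is $r\in\mathbb{C}^\times$ with $\gamma=[2]_r^{-2}$, and for every such $r$ the coefficients of $t_\gamma$ are $$c_{n,i}=\gamma^i\,\frac{[n-2i+1]_r}{[2]_r^{\,n-2i}},\qquad 0\le i\le\lfloor n/2\rfloor .$$ (c) If $\delta>2$ (that is, $q$ is a positive real number), then a trace $t$ on $TL_\infty$ has positive coefficients if and only if it is positive with respect to $*$, i.e. $t(aa^*)>0$ for all $a\in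 TL_\infty$ with $a\ne0$. So in this case the classification in (b) also holds for the set $S$ of normalized traces that are positive with respect to $*$. -/

import Mathlib

open scoped ComplexOrder

noncomputable section

namespace TemperleyLieb

/-! ## The algebras -/

/-- Indices of the generators of the algebra on `N` strands, `N ≤ ∞`: the index `i` stands for the
generator usually written `e_{i+1}`, which joins the strands `i+1` and `i+2`. -/
def Gen (N : ℕ∞) : Type := {i : ℕ // (i : ℕ∞) + 1 < N}

/-- The defining relations. -/
inductive Rel (δ : ℝ) (N : ℕ∞) : FreeAlgebra ℂ (Gen N) → FreeAlgebra ℂ (Gen N) → Prop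
  | sq (i : Gen N) :
      Rel δ N (FreeAlgebra.ι ℂ i * FreeAlgebra.ι ℂ i) ((δ : ℂ) • FreeAlgebra.ι ℂ i)
  | jones (i j : Gen N) (h : i.1 = j.1 + 1 ∨ j.1 = i.1 + 1) :
      Rel δ N (FreeAlgebra.ι ℂ i * FreeAlgebra.ι ℂ j * FreeAlgebra.ι ℂ i) (FreeAlgebra.ι ℂ i)
  | comm (i j : Gen N) (h : i.1 + 1 < j.1 ∨ j.1 + 1 < i.1) :
      Rel δ N (FreeAlgebra.ι ℂ i * FreeAlgebra.ι ℂ j) (FreeAlgebra.ι ℂ j * FreeAlgebra.ι ℂ i)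

/-- `TL δ n` is the Temperley–Lieb algebra on `n` strands with loop parameter `δ`, and `TL δ ⊤` is
the infinite Temperley–Lieb algebra, the union (direct limit) of all the `TL δ n`. -/
def TL (δ : ℝ) (N : ℕ∞) : Type := RingQuot (Rel δ N)

instance (δ : ℝ) (N : ℕ∞) : Ring (TL δ N) := inferInstanceAs (Ring (RingQuot (Rel δ N)))

instance (δ : ℝ) (N : ℕ∞) : Algebra ℂ (TL δ N) :=
  inferInstanceAs (Algebra ℂ (RingQuot (Rel δ N)))

variable {δ : ℝ} {N : ℕ∞}

/-- The generators. -/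
def e (i : Gen N) : TL δ N := RingQuot.mkAlgHom ℂ (Rel δ N) (FreeAlgebra.ι ℂ i)

theorem e_sq (i : Gen N) : (e i * e i : TL δ N) = (δ : ℂ) • e i := by
  have h := RingQuot.mkAlgHom_rel ℂ (Rel.sq (δ := δ) i)
  rw [map_mul, map_smul] at h
  exact h

theorem e_jones (i j : Gen N) (h : i.1 = j.1 + 1 ∨ j.1 = i.1 + 1) :
    (e i * e j * e i : TL δ N) = e i := by
  have h := RingQuot.mkAlgHom_rel ℂ (Rel.jones (δ := δ) i j h)
  rw [map_mul, map_mul] at h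
  exact h

theorem e_comm (i j : Gen N) (h : i.1 + 1 < j.1 ∨ j.1 + 1 < i.1) :
    (e i * e j : TL δ N) = e j * e i := by
  have h := RingQuot.mkAlgHom_rel ℂ (Rel.comm (δ := δ) i j h)
  rw [map_mul, map_mul] at h
  exact h

/-- The universal property of `TL δ N`. -/
def lift {A : Type*} [Ring A] [Algebra ℂ A] (g : Gen N → A)
    (h1 : ∀ i, g i * g i = (δ : ℂ) • g i)
    (h2 : ∀ i j : Gen N, i.1 = j.1 + 1 ∨ j.1 = i.1 + 1 → g i * g j * g i = g i)
    (h3 : ∀ i j : Gen N, i.1 + 1 < j.1 ∨ j.1 + 1 < i.1 → g i * g j = g j * g i) :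
    TL δ N →ₐ[ℂ] A :=
  RingQuot.liftAlgHom ℂ ⟨FreeAlgebra.lift ℂ g, by
    intro x y h
    cases h with
    | sq i => rw [map_mul, map_smul, FreeAlgebra.lift_ι_apply]; exact h1 i
    | jones i j h => simpa using h2 i j h
    | comm i j h => simpa using h3 i j h⟩

theorem lift_e {A : Type*} [Ring A] [Algebra ℂ A] (g : Gen N → A) (h1) (h2) (h3) (i : Gen N) :
    lift (δ := δ) g h1 h2 h3 (e i) = g i := by
  unfold lift e
  erw [RingQuot.liftAlgHom_mkAlgHom_apply]
  simp

theorem induction {P : TL δ N → Prop} (hc : ∀ c : ℂ, P (algebraMap ℂ _ c)) (he : ∀ i, P (e i))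
    (hm : ∀ a b, P a → P b → P (a * b)) (ha : ∀ a b, P a → P b → P (a + b)) (x : TL δ N) : P x := by
  obtain ⟨y, rfl⟩ := RingQuot.mkAlgHom_surjective ℂ (Rel δ N) x
  induction y using FreeAlgebra.induction with
  | grade0 r => rw [AlgHom.commutes]; exact hc r
  | grade1 i => exact he i
  | mul a b h1 h2 => rw [map_mul]; exact hm _ _ h1 h2
  | add a b h1 h2 => rw [map_add]; exact ha _ _ h1 h2

/-- The standard homomorphism `TL_n → TL_∞`, sending generators to generators. -/
def toInf (δ : ℝ) (n : ℕ) : TL δ n →ₐ[ℂ] TL δ ⊤ :=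
  lift (fun i => e ⟨i.1, lt_of_lt_of_le i.2 le_top⟩) (fun _ => e_sq _)
    (fun _ _ h => e_jones _ _ h) (fun _ _ h => e_comm _ _ h)

/-! ## The involution -/

/-- The opposite algebra of `A`, with scalars acting through complex conjugation. Algebra
homomorphisms `A → ConjOp A` are the conjugate-linear anti-endomorphisms of `A`. -/
def ConjOp (A : Type) : Type := Aᵐᵒᵖ

instance (A : Type) [Ring A] : Ring (ConjOp A) := inferInstanceAs (Ring Aᵐᵒᵖ)

instance (A : Type) [Ring A] [Algebra ℂ A] : Algebra ℂ (ConjOp A) :=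
  Algebra.compHom Aᵐᵒᵖ (starRingEnd ℂ)

/-- The identity map `A → ConjOp A`. -/
def toConj {A : Type} (x : A) : ConjOp A := MulOpposite.op x

/-- The identity map `ConjOp A → A`. -/
def ofConj {A : Type} (x : ConjOp A) : A := MulOpposite.unop x

section ConjOp

theorem ofConj_toConj {A : Type} (x : A) : ofConj (toConj x) = x := rfl

variable {A : Type} [Ring A]

theorem toConj_mul (x y : A) : toConj (x * y) = toConj y * toConj x := rfl

theorem ofConj_mul (x y : ConjOp A) : ofConj (x * y) = ofConj y * ofConj x := rfl

theorem ofConj_add (x y : ConjOp A) : ofConj (x + y) = ofConj x + ofConj y := rfl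

variable [Algebra ℂ A]

theorem smul_toConj (c : ℂ) (x : A) : c • toConj x = toConj (starRingEnd ℂ c • x) := rfl

theorem ofConj_smul (c : ℂ) (x : ConjOp A) : ofConj (c • x) = starRingEnd ℂ c • ofConj x := rfl

theorem ofConj_algebraMap (c : ℂ) :
    ofConj (algebraMap ℂ (ConjOp A) c) = algebraMap ℂ A (starRingEnd ℂ c) := rfl

end ConjOp

/-- The involution as an algebra homomorphism to the conjugate opposite algebra. -/
def starHom (δ : ℝ) (N : ℕ∞) : TL δ N →ₐ[ℂ] ConjOp (TL δ N) :=
  lift (fun i => toConj (e i))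
    (fun i => by
      rw [smul_toConj, Complex.conj_ofReal, ← e_sq, toConj_mul])
    (fun i j h => by
      rw [← toConj_mul, ← toConj_mul, ← mul_assoc, e_jones i j h])
    (fun i j h => by
      rw [← toConj_mul, ← toConj_mul, e_comm i j h])

/-- The involution `∗`: the conjugate-linear anti-automorphism fixing every generator. -/
instance : StarRing (TL δ N) where
  star x := ofConj (starHom δ N x)
  star_involutive x := by
    change ofConj (starHom δ N (ofConj (starHom δ N x))) = x
    induction x using induction with
    | hc c =>
      rw [AlgHom.commutes, ofConj_algebraMap, AlgHom.commutes, ofConj_algebraMap, Complex.conj_conj]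
    | he i => rw [starHom, lift_e, ofConj_toConj, lift_e, ofConj_toConj]
    | hm a b h1 h2 => rw [map_mul, ofConj_mul, map_mul, ofConj_mul, h1, h2]
    | ha a b h1 h2 => rw [map_add, ofConj_add, map_add, ofConj_add, h1, h2]
  star_mul a b := by
    change ofConj (starHom δ N (a * b)) = _
    rw [map_mul, ofConj_mul]
  star_add a b := by
    change ofConj (starHom δ N (a + b)) = _
    rw [map_add, ofConj_add]

theorem star_e (i : Gen N) : star (e i : TL δ N) = e i := by
  change ofConj (starHom δ N (e i)) = _
  rw [starHom, lift_e, ofConj_toConj]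

instance : StarModule ℂ (TL δ N) where
  star_smul c x := by
    change ofConj (starHom δ N (c • x)) = starRingEnd ℂ c • ofConj (starHom δ N x)
    rw [map_smul, ofConj_smul]

/-! ## Link states and the standard representations -/

section Merge

variable {α : Type*} [DecidableEq α]

/-- Pairings are encoded by involutions `f`: two points are joined if `f` swaps them, and a fixed
point is a through strand. `mergeFun a b f` is the result of joining `a` to `b`, and
the former partners of `a` and `b` to each other (if only one of `a`, `b` was on a through strand,
then the former partner of the other one is on that through strand now). -/
def mergeFun (a b : α) (f : α → α) (x : α) : α :=
  if x = a then b
  else if x = b then a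
  else if x = f a then (if f b = b then x else f b)
  else if x = f b then (if f a = a then x else f a)
  else f x

theorem mergeFun_invol {a b : α} {f : α → α} (hf : ∀ x, f (f x) = x) (x : α) :
    mergeFun a b f (mergeFun a b f x) = x := by
  unfold mergeFun
  grind

theorem mergeFun_idem {a b : α} {f : α → α} (hf : ∀ x, f (f x) = x) :
    mergeFun a b (mergeFun a b f) = mergeFun a b f := by
  funext x
  unfold mergeFun
  grind

theorem mergeFun_comm {a b c d : α} {f : α → α} (hf : ∀ x, f (f x) = x)
    (hab : a ≠ b) (hcd : c ≠ d) (hac : a ≠ c) (had : a ≠ d) (hbc : b ≠ c) (hbd : b ≠ d)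
    (h1 : f a ≠ a ∨ f b ≠ b) (h2 : f c ≠ c ∨ f d ≠ d)
    (h3 : mergeFun a b f c ≠ c ∨ mergeFun a b f d ≠ d)
    (h4 : mergeFun c d f a ≠ a ∨ mergeFun c d f b ≠ b) :
    mergeFun a b (mergeFun c d f) = mergeFun c d (mergeFun a b f) := by
  funext x
  unfold mergeFun at *
  grind (splits := 40)

theorem mergeFun_jones {a b c : α} {f : α → α} (hf : ∀ x, f (f x) = x)
    (hab : a ≠ b) (hac : a ≠ c) (hbc : b ≠ c) (h1 : f a ≠ a ∨ f b ≠ b) :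
    mergeFun a b (mergeFun b c (mergeFun a b f)) = mergeFun a b f := by
  funext x
  unfold mergeFun at *
  grind (splits := 40)

set_option maxHeartbeats 4000000 in
theorem mergeFun_noncrossing {n : ℕ} {a b : Fin n} (hab : (b : ℕ) = a + 1) {f : Fin n → Fin n}
    (hf : ∀ x, f (f x) = x)
    (hn : ∀ x y, x < y → y < f x → f y ≠ y ∧ x < f y ∧ f y < f x) (h1 : f a ≠ a ∨ f b ≠ b) :
    ∀ x y, x < y → y < mergeFun a b f x →
      mergeFun a b f y ≠ y ∧ x < mergeFun a b f y ∧ mergeFun a b f y < mergeFun a b f x := by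
  intro x y hxy
  have ea := hf a
  have eb := hf b
  have ex := hf x
  have ey := hf y
  have i1 := hn x y
  have i2 := hn a y
  have i3 := hn b y
  have i4 := hn (f a) y
  have i5 := hn (f b) y
  have i6 := hn x a
  have i7 := hn x b
  have i8 := hn a x
  have i9 := hn b x
  have i10 := hn (f a) x
  have i11 := hn (f b) x
  have i12 := hn (f a) b
  have i13 := hn a (f b)
  have i14 := hn (f b) a
  have i15 := hn b (f a)
  have i16 := hn a b
  have i17 := hn y a
  have i18 := hn y b
  have i19 := hn y (f a)
  have i20 := hn y (f b)
  have i21 := hn x (f a)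
  have i22 := hn x (f b)
  have i23 := hn b (f y)
  have i24 := hn a (f y)
  clear hn hf
  have inj : ∀ u v : Fin n, (u : ℕ) = v → u = v := fun u v h => Fin.ext h
  by_cases hxa : x = a
  · subst hxa
    simp only [mergeFun, if_true]
    omega
  by_cases hxb : x = b
  · subst hxb
    simp only [mergeFun, hxa, if_true, if_false]
    omega
  rw [show mergeFun a b f x = if x = f a then (if f b = b then x else f b)
    else if x = f b then (if f a = a then x else f a) else f x by simp [mergeFun, hxa, hxb]]
  by_cases hya : y = a
  · subst hya
    simp only [mergeFun, if_true]
    grind (splits := 30)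
  by_cases hyb : y = b
  · subst hyb
    simp only [mergeFun, hya, if_true, if_false]
    grind (splits := 30)
  rw [show mergeFun a b f y = if y = f a then (if f b = b then y else f b)
    else if y = f b then (if f a = a then y else f a) else f y by simp [mergeFun, hya, hyb]]
  have n1 : f y ≠ f a := fun h => hya (by rw [← ey, h, ea])
  have n2 : f y ≠ f b := fun h => hyb (by rw [← ey, h, eb])
  split_ifs <;> grind (splits := 30)

theorem mergeFun_card [Fintype α] {a b : α} (hab : a ≠ b) {f : α → α}
    (hf : ∀ x, f (f x) = x) (h1 : f a ≠ a ∨ f b ≠ b) :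
    (Finset.univ.filter fun x => mergeFun a b f x = x).card =
      (Finset.univ.filter fun x => f x = x).card := by
  apply Finset.card_bij' (i := fun x _ => if x = f a then b else if x = f b then a else x)
    (j := fun x _ => if x = a then f b else if x = b then f a else x) <;>
  · simp only [Finset.mem_filter, Finset.mem_univ, true_and]
    try unfold mergeFun
    grind
/-- The scalar picked up when the cup-cap on `a, b` acts on a pairing: `δ` for a closed loop, and `0`
if two through strands get joined to each other. -/
def mergeWeight (δ : ℝ) (a b : α) (f : α → α) : ℂ :=
  if f a = b then (δ : ℂ) else if f a = a ∧ f b = b then 0 else 1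

theorem mergeFun_symm {a b : α} (hab : a ≠ b) {f : α → α} (hf : ∀ x, f (f x) = x) :
    mergeFun b a f = mergeFun a b f := by
  funext x
  unfold mergeFun
  grind

theorem mergeWeight_symm {a b : α} {f : α → α} (hf : ∀ x, f (f x) = x) :
    mergeWeight δ b a f = mergeWeight δ a b f := by
  unfold mergeWeight
  grind

theorem mergeWeight_ne {a b : α} (hab : a ≠ b) {f : α → α} (hf : ∀ x, f (f x) = x)
    (h : ¬(f a = a ∧ f b = b)) :
    mergeWeight δ a b (mergeFun a b f) = δ := by
  unfold mergeWeight mergeFun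
  grind

theorem mergeWeight_jones {a b c : α} {f : α → α} (hf : ∀ x, f (f x) = x)
    (hab : a ≠ b) (hac : a ≠ c) (hbc : b ≠ c) :
    mergeWeight δ b c (mergeFun a b f) = 1 := by
  have : mergeFun a b f b = a := by unfold mergeFun; grind
  simp [mergeWeight, this, hab, hac]

theorem mergeWeight_comm {a b c d : α} {f : α → α} (hf : ∀ x, f (f x) = x)
    (hab : a ≠ b) (hcd : c ≠ d) (hac : a ≠ c) (had : a ≠ d) (hbc : b ≠ c) (hbd : b ≠ d)
    (h1 : ¬(f a = a ∧ f b = b)) (h2 : ¬(f c = c ∧ f d = d)) :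
    mergeWeight δ a b (mergeFun c d f) * mergeWeight δ c d f =
      mergeWeight δ c d (mergeFun a b f) * mergeWeight δ a b f := by
  unfold mergeWeight mergeFun
  grind (splits := 40)

/-- If one of the two orders of merging kills a pairing, so does the other one. -/
theorem kill_comm {a b c d : α} {f : α → α} (hf : ∀ x, f (f x) = x)
    (hab : a ≠ b) (hcd : c ≠ d) (hac : a ≠ c) (had : a ≠ d) (hbc : b ≠ c) (hbd : b ≠ d)
    (h1 : ¬(f a = a ∧ f b = b)) (h2 : f c = c ∧ f d = d) :
    mergeFun a b f c = c ∧ mergeFun a b f d = d := by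
  unfold mergeFun
  grind (splits := 40)

end Merge

/-- An `(n, p)`-link state: a non-crossing pairing of some of the `n` points into `p` cups, where
the remaining `n - 2p` points carry through strands, none of which lies below a cup. -/
@[ext]
structure LinkState (n p : ℕ) where
  /-- The partner of a point under the pairing; the point itself if it carries a through strand. -/
  partner : Fin n → Fin n
  invol : ∀ x, partner (partner x) = x
  noncrossing : ∀ x y, x < y → y < partner x →
    partner y ≠ y ∧ x < partner y ∧ partner y < partner x
  card_through : (Finset.univ.filter fun x => partner x = x).card + 2 * p = n

instance (n p : ℕ) : Finite (LinkState n p) :=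
  Finite.of_injective LinkState.partner fun _ _ h => LinkState.ext h

section Rep

variable {n p : ℕ}

theorem gen_lt (i : Gen n) : i.1 + 1 < n := by exact_mod_cast i.2

/-- The first of the two points joined by a generator. -/
def fstPt (i : Gen n) : Fin n := ⟨i.1, by have := gen_lt i; omega⟩

/-- The second of the two points joined by a generator. -/
def sndPt (i : Gen n) : Fin n := ⟨i.1 + 1, gen_lt i⟩

theorem fstPt_ne_sndPt (i : Gen n) : fstPt i ≠ sndPt i := by
  simp [fstPt, sndPt, Fin.ext_iff]

/-- Both points of the generator `i` carry through strands. -/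
def Kills (i : Gen n) (s : LinkState n p) : Prop :=
  s.partner (fstPt i) = fstPt i ∧ s.partner (sndPt i) = sndPt i

instance (i : Gen n) (s : LinkState n p) : Decidable (Kills i s) :=
  inferInstanceAs (Decidable (_ ∧ _))

/-- The link state obtained by concatenation with the generator `i`, up to a scalar (and a dummy
value if the concatenation has more than `p` cups). -/
def step (i : Gen n) (s : LinkState n p) : LinkState n p :=
  if h : Kills i s then s else
    { partner := mergeFun (fstPt i) (sndPt i) s.partner
      invol := mergeFun_invol s.invol
      noncrossing := mergeFun_noncrossing rfl s.invol s.noncrossing (not_and_or.1 h)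
      card_through := by
        rw [mergeFun_card (fstPt_ne_sndPt i) s.invol (not_and_or.1 h)]
        exact s.card_through }

/-- The scalar of the concatenation: `δ` if a loop is removed, `0` if the number of cups grows,
`1` otherwise. -/
def weight (δ : ℝ) (i : Gen n) (s : LinkState n p) : ℂ :=
  mergeWeight δ (fstPt i) (sndPt i) s.partner

theorem step_partner {i : Gen n} {s : LinkState n p} (h : ¬Kills i s) :
    (step i s).partner = mergeFun (fstPt i) (sndPt i) s.partner := by
  simp [step, h]

theorem weight_kills {i : Gen n} {s : LinkState n p} (h : Kills i s) : weight δ i s = 0 := by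
  have h' : s.partner (fstPt i) = fstPt i ∧ s.partner (sndPt i) = sndPt i := h
  simp [weight, mergeWeight, h', fstPt_ne_sndPt]

/-- The action of a generator on the span of link states. -/
def genAct (δ : ℝ) (i : Gen n) : Module.End ℂ (LinkState n p →₀ ℂ) :=
  Finsupp.linearCombination ℂ fun s => Finsupp.single (step i s) (weight δ i s)

theorem genAct_single (i : Gen n) (s : LinkState n p) (c : ℂ) :
    genAct δ i (Finsupp.single s c) = Finsupp.single (step i s) (c * weight δ i s) := by
  simp [genAct]

/-- The standard representation: `TL_n` acts on the space with basis the `(n, p)`-link states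
by concatenation, where link states with more than `p` cups are set to zero. -/
def standardRep (δ : ℝ) (n p : ℕ) : TL δ n →ₐ[ℂ] Module.End ℂ (LinkState n p →₀ ℂ) :=
  lift (fun i => genAct δ i)
    (fun i => by
      refine Finsupp.lhom_ext fun s c => ?_
      rw [Module.End.mul_apply, LinearMap.smul_apply]
      simp only [genAct_single]
      by_cases h : Kills i s
      · simp [weight_kills h]
      have h1 : step i (step i s) = step i s := by
        have hk : ¬Kills i (step i s) := by
          intro hk
          have h2 := hk.1
          rw [step_partner h] at h2
          simp [mergeFun, (fstPt_ne_sndPt i).symm] at h2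
        apply LinkState.ext
        rw [step_partner hk, step_partner h, mergeFun_idem s.invol]
      have h2 : weight δ i (step i s) = δ := by
        rw [weight, step_partner h, mergeWeight_ne (fstPt_ne_sndPt i) s.invol h]
      rw [h1, h2, Finsupp.smul_single, smul_eq_mul, mul_comm])
    (fun i j hij => by
      refine Finsupp.lhom_ext fun s c => ?_
      rw [Module.End.mul_apply, Module.End.mul_apply]
      simp only [genAct_single]
      by_cases h : Kills i s
      · simp [weight_kills h]
      obtain ⟨a, b, d, hab, had, hbd, hi, hj⟩ : ∃ a b d : Fin n, a ≠ b ∧ a ≠ d ∧ b ≠ d ∧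
          (fstPt i = a ∧ sndPt i = b ∨ fstPt i = b ∧ sndPt i = a) ∧
          (fstPt j = b ∧ sndPt j = d ∨ fstPt j = d ∧ sndPt j = b) := by
        rcases hij with hij | hij
        · exact ⟨sndPt i, fstPt i, fstPt j, by simp [fstPt, sndPt, Fin.ext_iff],
            by simp [fstPt, sndPt, Fin.ext_iff]; omega, by simp [fstPt, Fin.ext_iff]; omega,
            by simp, by simp [fstPt, sndPt, Fin.ext_iff]; omega⟩
        · exact ⟨fstPt i, sndPt i, sndPt j, by simp [fstPt, sndPt, Fin.ext_iff],
            by simp [fstPt, sndPt, Fin.ext_iff]; omega, by simp [sndPt, Fin.ext_iff]; omega,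
            by simp, by simp [fstPt, sndPt, Fin.ext_iff]; omega⟩
      have mi : ∀ f : Fin n → Fin n, (∀ x, f (f x) = x) →
          mergeFun (fstPt i) (sndPt i) f = mergeFun a b f := by
        intro f hf
        rcases hi with ⟨h1, h2⟩ | ⟨h1, h2⟩ <;> rw [h1, h2]
        exact mergeFun_symm hab hf
      have mj : ∀ f : Fin n → Fin n, (∀ x, f (f x) = x) →
          mergeFun (fstPt j) (sndPt j) f = mergeFun b d f := by
        intro f hf
        rcases hj with ⟨h1, h2⟩ | ⟨h1, h2⟩ <;> rw [h1, h2]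
        exact mergeFun_symm hbd hf
      have wi : ∀ f : Fin n → Fin n, (∀ x, f (f x) = x) →
          mergeWeight δ (fstPt i) (sndPt i) f = mergeWeight δ a b f := by
        intro f hf
        rcases hi with ⟨h1, h2⟩ | ⟨h1, h2⟩ <;> rw [h1, h2]
        exact mergeWeight_symm hf
      have wj : ∀ f : Fin n → Fin n, (∀ x, f (f x) = x) →
          mergeWeight δ (fstPt j) (sndPt j) f = mergeWeight δ b d f := by
        intro f hf
        rcases hj with ⟨h1, h2⟩ | ⟨h1, h2⟩ <;> rw [h1, h2]
        exact mergeWeight_symm hf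
      have w2 : weight δ j (step i s) = 1 := by
        rw [weight, wj _ (step i s).invol, step_partner h, mi _ s.invol]
        exact mergeWeight_jones s.invol hab had hbd
      have k2 : ¬Kills j (step i s) := fun hk => by
        rw [weight_kills hk] at w2
        exact zero_ne_one w2
      have w3 : weight δ i (step j (step i s)) = 1 := by
        rw [weight, wi _ (step j (step i s)).invol, step_partner k2, mj _ (step i s).invol,
          mergeWeight_symm (mergeFun_invol (step i s).invol), ← mergeFun_symm hbd (step i s).invol]
        exact mergeWeight_jones (step i s).invol hbd.symm had.symm hab.symm
      have k3 : ¬Kills i (step j (step i s)) := fun hk => by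
        rw [weight_kills hk] at w3
        exact zero_ne_one w3
      have h0 : s.partner a ≠ a ∨ s.partner b ≠ b := by
        rcases hi with ⟨h1, h2⟩ | ⟨h1, h2⟩
        · have := not_and_or.1 h
          rwa [h1, h2] at this
        · have := not_and_or.1 h
          rw [h1, h2] at this
          exact this.symm
      have h1 : step i (step j (step i s)) = step i s := by
        apply LinkState.ext
        rw [step_partner k3, mi _ (step j (step i s)).invol, step_partner k2,
          mj _ (step i s).invol, step_partner h, mi _ s.invol,
          mergeFun_jones s.invol hab had hbd h0]
      rw [h1, w2, w3, mul_one, mul_one])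
    (fun i j hij => by
      refine Finsupp.lhom_ext fun s c => ?_
      rw [Module.End.mul_apply, Module.End.mul_apply]
      simp only [genAct_single]
      have hac : fstPt i ≠ fstPt j := by simp [fstPt, Fin.ext_iff]; omega
      have had : fstPt i ≠ sndPt j := by simp [fstPt, sndPt, Fin.ext_iff]; omega
      have hbc : sndPt i ≠ fstPt j := by simp [fstPt, sndPt, Fin.ext_iff]; omega
      have hbd : sndPt i ≠ sndPt j := by simp [sndPt, Fin.ext_iff]; omega
      have hab := fstPt_ne_sndPt i
      have hcd := fstPt_ne_sndPt j
      by_cases h1 : Kills i s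
      · by_cases h2 : Kills j s
        · simp [weight_kills h1, weight_kills h2]
        · have : Kills i (step j s) := by
            rw [Kills, step_partner h2]
            exact kill_comm s.invol hcd hab hac.symm hbc.symm had.symm hbd.symm h2 h1
          simp [weight_kills h1, weight_kills this]
      by_cases h2 : Kills j s
      · have : Kills j (step i s) := by
          rw [Kills, step_partner h1]
          exact kill_comm s.invol hab hcd hac had hbc hbd h1 h2
        simp [weight_kills h2, weight_kills this]
      have hw : weight δ i (step j s) * weight δ j s = weight δ j (step i s) * weight δ i s := by
        rw [weight, weight, weight, weight, step_partner h1, step_partner h2]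
        exact mergeWeight_comm s.invol hab hcd hac had hbc hbd h1 h2
      have hw' : c * weight δ j s * weight δ i (step j s) =
          c * weight δ i s * weight δ j (step i s) := by
        linear_combination c * hw
      rw [hw']
      by_cases k1 : Kills j (step i s)
      · simp [weight_kills k1]
      by_cases k2 : Kills i (step j s)
      · rw [← hw']
        simp [weight_kills k2]
      have : step i (step j s) = step j (step i s) := by
        have k1' := not_and_or.1 k1
        have k2' := not_and_or.1 k2
        rw [step_partner h1] at k1'
        rw [step_partner h2] at k2'
        apply LinkState.ext
        rw [step_partner k1, step_partner k2, step_partner h1, step_partner h2]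
        exact mergeFun_comm s.invol hab hcd hac had hbc hbd (not_and_or.1 h1) (not_and_or.1 h2)
          k1' k2'
      rw [this])

/-- The matrix trace `t_{n,p}` of the standard representation (not normalized: its value
at `1` is the dimension of the representation). -/
def stdTrace (δ : ℝ) (n p : ℕ) : TL δ n →ₗ[ℂ] ℂ :=
  LinearMap.trace ℂ (LinkState n p →₀ ℂ) ∘ₗ (standardRep δ n p).toLinearMap

end Rep

/-! ## Traces -/

/-- A trace: a linear functional with `t (ab) = t (ba)`. -/
def IsTrace (t : TL δ ⊤ →ₗ[ℂ] ℂ) : Prop := ∀ a b, t (a * b) = t (b * a)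

/-- A trace is normalized if its value at `1` is `1`. -/
def IsNormalized (t : TL δ ⊤ →ₗ[ℂ] ℂ) : Prop := t 1 = 1

/-- `t (a a*)` is a positive real number for every nonzero `a`. -/
def IsStarPositive (t : TL δ ⊤ →ₗ[ℂ] ℂ) : Prop := ∀ a, a ≠ 0 → 0 < t (a * star a)

/-- The restriction of `t` to every `TL_n` is `∑_{0 ≤ i ≤ ⌊n/2⌋} c_{n,i} t_{n,i}`. -/
def HasCoeffs (t : TL δ ⊤ →ₗ[ℂ] ℂ) (c : ℕ → ℕ → ℂ) : Prop :=
  ∀ (n : ℕ) (x : TL δ n),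
    t (toInf δ n x) = ∑ i ∈ Finset.range (n / 2 + 1), c n i * stdTrace δ n i x

/-- All the coefficients `c_{n,i}`, `0 ≤ i ≤ ⌊n/2⌋`, are positive real numbers. -/
def IsCoeffPositive (t : TL δ ⊤ →ₗ[ℂ] ℂ) : Prop :=
  ∃ c : ℕ → ℕ → ℂ, HasCoeffs t c ∧ ∀ n i, 2 * i ≤ n → 0 < c n i

/-- The quantum integers `[n]_r`. -/
def qInt (r : ℂ) : ℕ → ℂ
  | 0 => 0
  | 1 => 1
  | n + 2 => (r + r⁻¹) * qInt r (n + 1) - qInt r n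

theorem qInt_mul (r : ℂ) (hr : r ≠ 0) (n : ℕ) : (r - r⁻¹) * qInt r n = r ^ n - r⁻¹ ^ n := by
  induction n using Nat.strong_induction_on with
  | _ n ih =>
    match n with
    | 0 => simp [qInt]
    | 1 => simp [qInt]
    | n + 2 =>
      have h1 := ih (n + 1) (by omega)
      have h2 := ih n (by omega)
      have h3 : r * r⁻¹ = 1 := mul_inv_cancel₀ hr
      rw [qInt]
      linear_combination (r + r⁻¹) * h1 - h2 + (r ^ n - r⁻¹ ^ n) * h3

/-- The extremal elements of a set `S` of normalized traces (those which are not a proper convex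
combination of two elements of `S`) form a one-parameter family, indexed bijectively
by `0 < γ ≤ 1/4`, and the coefficients of the extremal trace indexed by `γ` are
`γ ^ i [n - 2i + 1]_r / [2]_r ^ (n - 2i)` where `γ = [2]_r ^ (-2)`. -/
def ExtremalsClassified (S : Set (TL δ ⊤ →ₗ[ℂ] ℂ)) : Prop :=
  ∃ T : ℝ → (TL δ ⊤ →ₗ[ℂ] ℂ),
    Set.BijOn T (Set.Ioc 0 (1 / 4)) (S.extremePoints ℝ) ∧
    ∀ γ ∈ Set.Ioc (0 : ℝ) (1 / 4),
      (∃ r : ℂ, r ≠ 0 ∧ (γ : ℂ) = (qInt r 2 ^ 2)⁻¹) ∧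
      ∀ r : ℂ, r ≠ 0 → (γ : ℂ) = (qInt r 2 ^ 2)⁻¹ →
        HasCoeffs (T γ) fun n i => (γ : ℂ) ^ i * qInt r (n - 2 * i + 1) / qInt r 2 ^ (n - 2 * i)

end TemperleyLieb

end

noncomputable section

namespace TemperleyLieb

variable {δ : ℝ} {N : ℕ∞}

/-! ## Generators indexed by natural numbers -/

/-! Traces are converted into linear functionals on ℝ[X], where the extreme points can be computed.

Since q is not a root of unity, no quantum integer [m+1] vanishes, so the Jones–Wenzl projections
exist. Telescoping their recursion writes 1 as a projection plus multiples of x g x*, always with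
the same generator g (`jw_add_sum`). Together with the compression g y g = g z, where z lives on the
strands to the right of g (`compress`), this reduces every trace on TL_n to its values at the
elements `cupProj p n`: p cups next to a Jones–Wenzl projection (`trace_eq_zero`). The standard
traces are diagonal on these elements, t_{n,j}(`cupProj p n`) being δ^p if j = p and 0 otherwise.
Hence coefficients exist, are unique, and equal δ^{-p} t(`cupProj p n`); this is (a).

The Jones–Wenzl recursion relates n and n + 1 strands: c_{n,p} = c_{n+1,p} + c_{n+1,p+1}, and
c_{2p,p} = c_{2p+1,p} at the boundary. Conversely every such array comes from a trace
(`IsHarmonic.exists_trace`). The array is determined by its diagonal L(X^m) = c_{2m,m}, through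
c_{n,i} = L(X^i Q_{n-2i}) with Q = `walkPoly`. So for (b) one needs the extreme points of the set of
normalized L that are positive on all X^i Q_k.

This positivity is preserved under multiplication by X and by 1 − X. Splitting L along 1 = X + (1 −
X) shows that an extreme L satisfies L(Xf) = L(X) L(f), so it is evaluation at some γ, and
positivity of all Q_k(γ) forces γ ≤ 1/4. Conversely, Bernstein polynomials give L(X^m (X − γ)²) ≥ 0
for every positive L. If evaluation at γ is a convex combination, both parts therefore vanish on
these polynomials, and growth of moments identifies each with the evaluation
(`eq_leval_of_convex_combination`).

For (c), δ > 2 makes all quantum integers positive, and the same reduction expresses t(aa*) as a sum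
with nonnegative weights of the values at `cupProj`, vanishing only for a = 0 (`trace_mul_star`).
The other direction holds because `cupProj` times its adjoint is δ^p `cupProj`. -/

/-- The generator with index `i`, and `0` if there is no such generator. -/
def gen (δ : ℝ) (N : ℕ∞) (i : ℕ) : TL δ N := if h : (i : ℕ∞) + 1 < N then e ⟨i, h⟩ else 0

theorem gen_mul_self (i : ℕ) : gen δ N i * gen δ N i = (δ : ℂ) • gen δ N i := by
  unfold gen
  split_ifs
  · exact e_sq _
  · simp

theorem gen_comm {i j : ℕ} (h : i + 1 < j ∨ j + 1 < i) :
    gen δ N i * gen δ N j = gen δ N j * gen δ N i := by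
  unfold gen
  split_ifs
  · exact e_comm _ _ h
  all_goals simp

/-- No bound is needed: if the index i + 1 exists then so does i, and otherwise both sides are 0.
The mirrored relation `gen_jones` does need one, since there the middle generator may be 0 while the
outer one is not. -/
theorem gen_succ_jones (i : ℕ) :
    gen δ N (i + 1) * gen δ N i * gen δ N (i + 1) = gen δ N (i + 1) := by
  unfold gen
  split_ifs with h1 h2
  · exact e_jones _ _ (Or.inl rfl)
  · exact absurd (lt_of_le_of_lt (by push_cast; exact le_self_add) h1) h2
  all_goals simp

theorem gen_jones (i : ℕ) (h : ((i + 1 : ℕ) : ℕ∞) + 1 < N) :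
    gen δ N i * gen δ N (i + 1) * gen δ N i = gen δ N i := by
  have h2 : (i : ℕ∞) + 1 < N := lt_of_le_of_lt (by push_cast; exact le_self_add) h
  rw [gen, gen, dif_pos h, dif_pos h2]
  exact e_jones _ _ (Or.inr rfl)

theorem star_gen (i : ℕ) : star (gen δ N i) = gen δ N i := by
  unfold gen
  split_ifs
  · exact star_e _
  · simp

/-- The subalgebra of the Temperley-Lieb algebra on the strands `a, ..., n - 1`. -/
def strands (δ : ℝ) (N : ℕ∞) (a n : ℕ) : Subalgebra ℂ (TL δ N) :=
  Algebra.adjoin ℂ (gen δ N '' {i | a ≤ i ∧ i + 1 < n})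

theorem gen_mem_strands {a n i : ℕ} (h1 : a ≤ i) (h2 : i + 1 < n) :
    gen δ N i ∈ strands δ N a n :=
  Algebra.subset_adjoin ⟨i, ⟨h1, h2⟩, rfl⟩

theorem strands_mono {a b m n : ℕ} (h1 : b ≤ a) (h2 : n ≤ m) :
    strands δ N a n ≤ strands δ N b m :=
  Algebra.adjoin_mono (Set.image_mono fun _ h => ⟨h1.trans h.1, h.2.trans_le h2⟩)

theorem strands_induction {a n : ℕ} {p : TL δ N → Prop}
    (hg : ∀ i, a ≤ i → i + 1 < n → p (gen δ N i)) (hc : ∀ c : ℂ, p (algebraMap ℂ _ c))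
    (ha : ∀ x y, p x → p y → p (x + y)) (hm : ∀ x y, p x → p y → p (x * y))
    {y : TL δ N} (hy : y ∈ strands δ N a n) : p y := by
  induction hy using Algebra.adjoin_induction with
  | mem x hx => obtain ⟨i, ⟨h1, h2⟩, rfl⟩ := hx; exact hg i h1 h2
  | algebraMap c => exact hc c
  | add x y _ _ h1 h2 => exact ha x y h1 h2
  | mul x y _ _ h1 h2 => exact hm x y h1 h2

theorem star_mem_strands {a n : ℕ} {y : TL δ N} (hy : y ∈ strands δ N a n) :
    star y ∈ strands δ N a n := by
  refine strands_induction (p := fun y => star y ∈ strands δ N a n) (fun i h1 h2 => ?_)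
    (fun c => ?_) (fun x y h1 h2 => ?_) (fun x y h1 h2 => ?_) hy
  · rw [star_gen]; exact gen_mem_strands h1 h2
  · rw [Algebra.algebraMap_eq_smul_one, star_smul, star_one]
    exact Subalgebra.smul_mem _ (one_mem _) _
  · rw [star_add]; exact add_mem h1 h2
  · rw [star_mul]; exact mul_mem h2 h1

theorem strands_commute {a n b m : ℕ} (h : n ≤ b) {x y : TL δ N} (hx : x ∈ strands δ N a n)
    (hy : y ∈ strands δ N b m) : Commute x y := by
  refine strands_induction (p := fun x => Commute x y) (fun i h1 h2 => ?_)
    (fun c => Algebra.commutes c y) (fun _ _ => Commute.add_left) (fun _ _ => Commute.mul_left) hx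
  refine strands_induction (p := fun y => Commute (gen δ N i) y) (fun j h3 h4 => ?_)
    (fun c => (Algebra.commutes c _).symm) (fun _ _ => Commute.add_right)
    (fun _ _ => Commute.mul_right) hy
  exact gen_comm (Or.inl (by omega))

/-! ## Quantum integers and Jones-Wenzl projections -/

/-- The quantum integers with `[2] = δ`. -/
def quantumInt (δ : ℝ) : ℕ → ℝ
  | 0 => 0
  | 1 => 1
  | n + 2 => δ * quantumInt δ (n + 1) - quantumInt δ n

/-- The ratio `[k + 1] / [k + 2]`. -/
def ratio (δ : ℝ) (k : ℕ) : ℝ := quantumInt δ (k + 1) / quantumInt δ (k + 2)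

/-- The Jones-Wenzl projection on the `k` strands `a, ..., a + k - 1`. -/
def jw (δ : ℝ) (N : ℕ∞) (a : ℕ) : ℕ → TL δ N
  | 0 => 1
  | 1 => 1
  | k + 2 => jw δ N a (k + 1) -
      (ratio δ k : ℂ) • (jw δ N a (k + 1) * gen δ N (a + k) * jw δ N a (k + 1))

theorem jw_succ_succ (a k : ℕ) : jw δ N a (k + 2) = jw δ N a (k + 1) -
    (ratio δ k : ℂ) • (jw δ N a (k + 1) * gen δ N (a + k) * jw δ N a (k + 1)) := rfl

theorem jw_mem_strands (a : ℕ) : ∀ k, jw δ N a k ∈ strands δ N a (a + k)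
  | 0 => one_mem _
  | 1 => one_mem _
  | k + 2 => by
    have h := strands_mono (δ := δ) (N := N) le_rfl (show a + (k + 1) ≤ a + (k + 2) by omega)
      (jw_mem_strands a (k + 1))
    exact sub_mem h (Subalgebra.smul_mem _ (mul_mem (mul_mem h
      (gen_mem_strands (by omega) (by omega))) h) _)

theorem star_jw (a : ℕ) : ∀ k, star (jw δ N a k) = jw δ N a k
  | 0 => star_one _
  | 1 => star_one _
  | k + 2 => by
    rw [jw_succ_succ, star_sub, star_smul, star_mul, star_mul, star_gen, star_jw a (k + 1),
      mul_assoc]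
    simp

theorem jw_commute_gen (a k : ℕ) : Commute (jw δ N a k) (gen δ N (a + k)) :=
  strands_commute le_rfl (jw_mem_strands a k) (gen_mem_strands le_rfl (Nat.lt_succ_self _))

/-- The recursive characterisation of the Jones-Wenzl projections. -/
structure IsJW (δ : ℝ) (N : ℕ∞) (a k : ℕ) : Prop where
  idem : jw δ N a (k + 1) * jw δ N a (k + 1) = jw δ N a (k + 1)
  gen_mul : ∀ i, a ≤ i → i < a + k → gen δ N i * jw δ N a (k + 1) = 0
  pred_mul : jw δ N a k * jw δ N a (k + 1) = jw δ N a (k + 1)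
  sandwich : gen δ N (a + k) * jw δ N a (k + 1) * gen δ N (a + k) =
    ((quantumInt δ (k + 2) / quantumInt δ (k + 1) : ℝ) : ℂ) • (jw δ N a k * gen δ N (a + k))

/-- The four properties feed each other in one induction: `sandwich` at k says that `ratio δ k` is
exactly the coefficient that makes the new generator kill the next projection. No bound on a + k is
required, because only `gen_succ_jones` is used. -/
theorem isJW (hU : ∀ m, quantumInt δ (m + 1) ≠ 0) (a k : ℕ) : IsJW δ N a k := by
  induction k with
  | zero =>
    refine ⟨by simp [jw], fun i h1 h2 => by omega, by simp [jw], ?_⟩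
    simp [jw, quantumInt, gen_mul_self]
  | succ k ih =>
    obtain ⟨h1, h2, h3, h4⟩ := ih
    have hc : ((quantumInt δ (k + 2) / quantumInt δ (k + 1) : ℝ) : ℂ) * (ratio δ k : ℂ) = 1 := by
      have := hU k
      have := hU (k + 1)
      rw [← Complex.ofReal_mul, ratio]
      norm_cast
      field_simp
    have hmem := jw_commute_gen (δ := δ) (N := N) a (k + 1)
    have hmem0 := jw_commute_gen (δ := δ) (N := N) a k
    set P := jw δ N a (k + 1)
    set P0 := jw δ N a k
    set g := gen δ N (a + k)
    have h5 : g * P * g * P = ((quantumInt δ (k + 2) / quantumInt δ (k + 1) : ℝ) : ℂ) • (g * P) := by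
      rw [h4, smul_mul_assoc, hmem0.eq, mul_assoc, h3]
    have h6 : g * jw δ N a (k + 2) = 0 := by
      rw [jw_succ_succ, mul_sub, mul_smul_comm, ← mul_assoc, ← mul_assoc, h5, smul_smul, mul_comm,
        hc, one_smul, sub_self]
    have h7 : P * jw δ N a (k + 2) = jw δ N a (k + 2) := by
      rw [jw_succ_succ, mul_sub, mul_smul_comm, ← mul_assoc, ← mul_assoc, h1]
    refine ⟨?_, fun i hi1 hi2 => ?_, h7, ?_⟩
    · conv_lhs => lhs; rw [show k + 1 + 1 = k + 2 from rfl, jw_succ_succ]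
      rw [sub_mul, h7, smul_mul_assoc, mul_assoc, h7, mul_assoc, h6]
      simp
    · rcases Nat.lt_succ_iff_lt_or_eq.1 (show i < (a + k) + 1 by omega) with h | rfl
      · rw [show k + 1 + 1 = k + 2 from rfl, jw_succ_succ, mul_sub, mul_smul_comm, ← mul_assoc,
          ← mul_assoc, h2 i hi1 h]
        simp
      · exact h6
    · have hg := gen_succ_jones (δ := δ) (N := N) (a + k)
      have hsq := gen_mul_self (δ := δ) (N := N) (a + k + 1)
      change gen δ N (a + k + 1) * jw δ N a (k + 2) * gen δ N (a + k + 1) = _ • (P * gen δ N (a + k + 1))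
      change Commute P (gen δ N (a + k + 1)) at hmem
      set g' := gen δ N (a + k + 1)
      -- `P` lives on strands disjoint from those of `g'`, so both copies of `P` move outward and
      -- leave the Jones relation for g' g g'. The remaining scalar is δ − [k+1]/[k+2] =
      -- [k+3]/[k+2].
      have h8 : g' * (P * g * P) * g' = P * g' := by
        calc g' * (P * g * P) * g' = (g' * P) * g * (P * g') := by simp only [mul_assoc]
          _ = P * (g' * g * g') * P := by
            rw [show g' * P * g * (P * g') = P * g' * g * (g' * P) by rw [hmem.eq]]
            simp only [mul_assoc]
          _ = P * g' := by rw [hg, mul_assoc, ← hmem.eq, ← mul_assoc, h1]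
      have h9 : g' * P * g' = (δ : ℂ) • (P * g') := by
        rw [← hmem.eq, mul_assoc, hsq, mul_smul_comm]
      rw [jw_succ_succ, mul_sub, sub_mul, mul_smul_comm, smul_mul_assoc, h8, h9, ← sub_smul]
      congr 1
      have := hU (k + 1)
      rw [ratio, ← Complex.ofReal_sub]
      congr 1
      rw [show quantumInt δ (k + 1 + 2) = δ * quantumInt δ (k + 2) - quantumInt δ (k + 1) from rfl]
      field_simp

/-! ### Products with Jones–Wenzl projections. -/

theorem gen_mul_jw (hU : ∀ m, quantumInt δ (m + 1) ≠ 0) {a k i : ℕ} (h1 : a ≤ i)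
    (h2 : i + 1 < a + k) : gen δ N i * jw δ N a k = 0 := by
  obtain ⟨k, rfl⟩ : ∃ l, k = l + 1 := ⟨k - 1, by omega⟩
  exact (isJW hU a k).gen_mul i h1 (by omega)

theorem jw_mul_gen (hU : ∀ m, quantumInt δ (m + 1) ≠ 0) {a k i : ℕ} (h1 : a ≤ i)
    (h2 : i + 1 < a + k) : jw δ N a k * gen δ N i = 0 := by
  have := congrArg star (gen_mul_jw (N := N) hU h1 h2)
  rwa [star_mul, star_gen, star_jw, star_zero] at this

theorem jw_mul_self (hU : ∀ m, quantumInt δ (m + 1) ≠ 0) (a k : ℕ) :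
    jw δ N a k * jw δ N a k = jw δ N a k := by
  cases k with
  | zero => simp [jw]
  | succ k => exact (isJW hU a k).idem

theorem exists_mul_jw (hU : ∀ m, quantumInt δ (m + 1) ≠ 0) {a k : ℕ} {y : TL δ N}
    (hy : y ∈ strands δ N a (a + k)) : ∃ c : ℂ, y * jw δ N a k = c • jw δ N a k := by
  refine strands_induction (p := fun y => ∃ c : ℂ, y * jw δ N a k = c • jw δ N a k)
    (fun i h1 h2 => ⟨0, ?_⟩) (fun c => ⟨c, ?_⟩) ?_ ?_ hy
  · rw [gen_mul_jw hU h1 h2, zero_smul]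
  · rw [Algebra.smul_def]
  · rintro x y ⟨c, hc⟩ ⟨d, hd⟩
    exact ⟨c + d, by rw [add_mul, hc, hd, add_smul]⟩
  · rintro x y ⟨c, hc⟩ ⟨d, hd⟩
    exact ⟨d * c, by rw [mul_assoc, hd, mul_smul_comm, hc, smul_smul]⟩

theorem exists_jw_mul (hU : ∀ m, quantumInt δ (m + 1) ≠ 0) {a k : ℕ} {y : TL δ N}
    (hy : y ∈ strands δ N a (a + k)) : ∃ c : ℂ, jw δ N a k * y = c • jw δ N a k := by
  obtain ⟨c, hc⟩ := exists_mul_jw hU (star_mem_strands hy)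
  refine ⟨star c, ?_⟩
  have := congrArg star hc
  rwa [star_mul, star_star, star_jw, star_smul, star_jw] at this

/-! ### A resolution of the identity. -/

/-- The product `g_{a+l} ⋯ g_{a+1}`, which moves `g_a` to `g_{a+l}`. -/
def mover (δ : ℝ) (N : ℕ∞) (a : ℕ) : ℕ → TL δ N
  | 0 => 1
  | l + 1 => gen δ N (a + l + 1) * mover δ N a l

theorem mover_mem_strands (a : ℕ) : ∀ l, mover δ N a l ∈ strands δ N a (a + l + 2)
  | 0 => one_mem _
  | l + 1 => mul_mem (gen_mem_strands (by omega) (by omega))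
      (strands_mono le_rfl (by omega) (mover_mem_strands a l))

theorem mover_mul_gen_mul_star (a : ℕ) :
    ∀ l, mover δ N a l * gen δ N a * star (mover δ N a l) = gen δ N (a + l)
  | 0 => by simp [mover]
  | l + 1 => by
    have h := mover_mul_gen_mul_star a l
    calc mover δ N a (l + 1) * gen δ N a * star (mover δ N a (l + 1))
        = gen δ N (a + l + 1) * (mover δ N a l * gen δ N a * star (mover δ N a l)) *
            gen δ N (a + l + 1) := by
          simp only [mover, star_mul, star_gen, mul_assoc]
      _ = _ := by rw [h]; exact gen_succ_jones _

/-- The elements in the resolution `1 = jw + ∑ ratio • x g x*`. -/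
def resElt (δ : ℝ) (N : ℕ∞) (a l : ℕ) : TL δ N := jw δ N a (l + 1) * mover δ N a l

theorem resElt_mem_strands {a l m : ℕ} (h : a + l + 2 ≤ m) : resElt δ N a l ∈ strands δ N a m :=
  mul_mem (strands_mono le_rfl (by omega) (jw_mem_strands a (l + 1)))
    (strands_mono le_rfl h (mover_mem_strands a l))

/-- The sum telescopes: by the recursion, the l-th term is the difference of two successive
projections, once g_{a+l} is rewritten as a conjugate of g_a. Having the same g_a in every term lets
later inductions add one cup at a fixed place. -/
theorem jw_add_sum (a k : ℕ) : jw δ N a k + ∑ l ∈ Finset.range (k - 1),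
    (ratio δ l : ℂ) • (resElt δ N a l * gen δ N a * star (resElt δ N a l)) = 1 := by
  induction k with
  | zero => simp [jw]
  | succ k ih =>
    cases k with
    | zero => simp [jw]
    | succ k =>
      rw [show k + 1 + 1 - 1 = k + 1 from rfl, Finset.sum_range_succ]
      rw [show k + 1 - 1 = k from rfl] at ih
      conv_rhs => rw [← ih]
      have : resElt δ N a k * gen δ N a * star (resElt δ N a k) =
          jw δ N a (k + 1) * gen δ N (a + k) * jw δ N a (k + 1) := by
        rw [← mover_mul_gen_mul_star]
        simp only [resElt, star_mul, star_jw, mul_assoc]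
      rw [this, show k + 1 + 1 = k + 2 from rfl, jw_succ_succ]
      abel

/-! ## Compression -/

/-- The span of the elements of `strands a n` in which `gen a` occurs at most once. -/
def reduced (δ : ℝ) (N : ℕ∞) (a n : ℕ) : Submodule ℂ (TL δ N) :=
  Submodule.span ℂ ((strands δ N (a + 1) n : Set (TL δ N)) ∪
    {y | ∃ x ∈ strands δ N (a + 1) n, ∃ x' ∈ strands δ N (a + 1) n, y = x * gen δ N a * x'})

/-- Words are built from the left, one generator at a time. The only problematic case is a second
g_a, and the hypothesis absorbs it by turning g_a x g_a into g_a z. -/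
theorem strands_le_reduced {a n : ℕ} (hc : ∀ y ∈ strands δ N (a + 1) n,
    ∃ z ∈ strands δ N (a + 2) n, gen δ N a * y * gen δ N a = gen δ N a * z) :
    Subalgebra.toSubmodule (strands δ N a n) ≤ reduced δ N a n := by
  rw [strands, Algebra.adjoin_eq_span, Submodule.span_le]
  intro y hy
  induction hy using Submonoid.closure_induction_left with
  | one => exact Submodule.subset_span (Or.inl (one_mem _))
  | mul_left x hx y hy ih =>
    clear hy
    obtain ⟨i, ⟨h1, h2⟩, rfl⟩ := hx
    change _ ∈ reduced δ N a n
    change y ∈ reduced δ N a n at ih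
    induction ih using Submodule.span_induction with
    | zero => rw [mul_zero]; exact zero_mem _
    | add u v _ _ hu hv => rw [mul_add]; exact add_mem hu hv
    | smul c u _ hu => rw [mul_smul_comm]; exact Submodule.smul_mem _ _ hu
    | mem u hu =>
      rcases h1.eq_or_lt with rfl | h1
      · rcases hu with hu | ⟨x, hx, x', hx', rfl⟩
        · exact Submodule.subset_span (Or.inr ⟨1, one_mem _, u, hu, by rw [one_mul]⟩)
        · obtain ⟨z, hz, h⟩ := hc x hx
          refine Submodule.subset_span (Or.inr ⟨1, one_mem _, z * x',
            mul_mem (strands_mono (by omega) le_rfl hz) hx', ?_⟩)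
          rw [one_mul, ← mul_assoc, ← mul_assoc, h, mul_assoc]
      · have hi := gen_mem_strands (δ := δ) (N := N) (Nat.succ_le_iff.2 h1) h2
        rcases hu with hu | ⟨x, hx, x', hx', rfl⟩
        · exact Submodule.subset_span (Or.inl (mul_mem hi hu))
        · exact Submodule.subset_span (Or.inr ⟨_, mul_mem hi hx, x', hx', by
            simp only [mul_assoc]⟩)

theorem gen_commute_strands {a b n : ℕ} (h : a + 2 ≤ b) {z : TL δ N} (hz : z ∈ strands δ N b n) :
    Commute (gen δ N a) z :=
  strands_commute h (gen_mem_strands le_rfl (Nat.lt_succ_self _)) hz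

theorem compress_span {a n : ℕ} {s : Set (TL δ N)}
    (h : ∀ y ∈ s, ∃ z ∈ strands δ N (a + 2) n, gen δ N a * y * gen δ N a = gen δ N a * z) :
    ∀ y ∈ Submodule.span ℂ s,
      ∃ z ∈ strands δ N (a + 2) n, gen δ N a * y * gen δ N a = gen δ N a * z := by
  intro y hy
  induction hy using Submodule.span_induction with
  | zero => exact ⟨0, zero_mem _, by simp⟩
  | add u v _ _ h1 h2 =>
    obtain ⟨z, hz, h1⟩ := h1
    obtain ⟨w, hw, h2⟩ := h2
    exact ⟨z + w, add_mem hz hw, by rw [mul_add, add_mul, h1, h2, mul_add]⟩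
  | smul c u _ hu =>
    obtain ⟨z, hz, hu⟩ := hu
    exact ⟨c • z, Subalgebra.smul_mem _ hz _, by
      rw [mul_smul_comm, smul_mul_assoc, hu, mul_smul_comm]⟩
  | mem u hu => exact h u hu

theorem compress_of_mem {a n : ℕ} {y : TL δ N} (hy : y ∈ strands δ N (a + 2) n) :
    gen δ N a * y * gen δ N a = gen δ N a * ((δ : ℂ) • y) := by
  rw [mul_assoc, ← (gen_commute_strands le_rfl hy).eq, ← mul_assoc, gen_mul_self,
    smul_mul_assoc, mul_smul_comm]

/-- Induction on the number of strands to the right of a. The statement for a + 1 puts y into a form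
with at most one g_{a+1}; g_a commutes with everything else there, and g_a g_{a+1} g_a = g_a removes
that one occurrence. -/
theorem compress_succ (n a : ℕ) : ∀ y ∈ strands δ N (a + 1) n,
    ∃ z ∈ strands δ N (a + 2) n, gen δ N a * y * gen δ N a = gen δ N a * z := by
  have key : ∀ d a, n ≤ a + 2 + d → ∀ y ∈ strands δ N (a + 1) n,
      ∃ z ∈ strands δ N (a + 2) n, gen δ N a * y * gen δ N a = gen δ N a * z := by
    intro d
    induction d with
    | zero =>
      intro a h y hy
      -- Here n ≤ a + 2, so no index i ≥ a + 1 satisfies i + 1 < n and the generating set is empty.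
      have hy' : y ∈ strands δ N (a + 2) n := by
        refine Algebra.adjoin_mono (Set.image_mono ?_) hy
        rintro i ⟨h1, h2⟩
        exact ⟨by omega, h2⟩
      exact ⟨_, Subalgebra.smul_mem _ hy' _, compress_of_mem hy'⟩
    | succ d ih =>
      intro a h y hy
      refine compress_span ?_ y (strands_le_reduced (ih (a + 1) (by omega)) hy)
      rintro u (hu | ⟨x, hx, x', hx', rfl⟩)
      · exact ⟨_, Subalgebra.smul_mem _ hu _, compress_of_mem hu⟩
      · have h1 : gen δ N a * (x * gen δ N (a + 1) * x') * gen δ N a =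
            x * (gen δ N a * gen δ N (a + 1) * gen δ N a) * x' := by
          have e1 := (gen_commute_strands le_rfl hx).eq
          have e2 := (gen_commute_strands le_rfl hx').eq
          calc _ = (gen δ N a * x) * gen δ N (a + 1) * (x' * gen δ N a) := by
                simp only [mul_assoc]
            _ = _ := by rw [e1, ← e2]; simp only [mul_assoc]
        by_cases hN : ((a + 1 : ℕ) : ℕ∞) + 1 < N
        · refine ⟨x * x', mul_mem hx hx', ?_⟩
          rw [h1, gen_jones a hN, ← (gen_commute_strands le_rfl hx).eq, mul_assoc]
        · refine ⟨0, zero_mem _, ?_⟩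
          rw [h1, show gen δ N (a + 1) = 0 from dif_neg hN]
          simp
  exact key n a (by omega)

/-- Algebraically, this is the closing of the strands a and a + 1 by a cup and a cap. Unlike in
`compress_succ`, y may contain g_a itself; in reduced form it occurs once and the two halves are
compressed separately. -/
theorem compress (n a : ℕ) : ∀ y ∈ strands δ N a n,
    ∃ z ∈ strands δ N (a + 2) n, gen δ N a * y * gen δ N a = gen δ N a * z := by
  intro y hy
  refine compress_span ?_ y (strands_le_reduced (compress_succ n a) hy)
  rintro u (hu | ⟨x, hx, x', hx', rfl⟩)
  · exact compress_succ n a u hu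
  · obtain ⟨z, hz, h1⟩ := compress_succ n a x hx
    obtain ⟨w, hw, h2⟩ := compress_succ n a x' hx'
    refine ⟨z * w, mul_mem hz hw, ?_⟩
    calc gen δ N a * (x * gen δ N a * x') * gen δ N a
        = (gen δ N a * x * gen δ N a) * (x' * gen δ N a) := by simp only [mul_assoc]
      _ = z * (gen δ N a * x' * gen δ N a) := by
        rw [h1, (gen_commute_strands le_rfl hz).eq]; simp only [mul_assoc]
      _ = gen δ N a * (z * w) := by
        rw [h2, ← mul_assoc, ← (gen_commute_strands le_rfl hz).eq, mul_assoc]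

/-! ## Traces and the elements `cups p * jw` -/

/-- The product `g_0 g_2 ⋯ g_{2p-2}`. -/
def cups (δ : ℝ) (N : ℕ∞) : ℕ → TL δ N
  | 0 => 1
  | p + 1 => cups δ N p * gen δ N (2 * p)

/-- `p` cups on the first `2p` strands next to the Jones-Wenzl projection on the remaining ones. -/
def cupProj (δ : ℝ) (N : ℕ∞) (p n : ℕ) : TL δ N := cups δ N p * jw δ N (2 * p) (n - 2 * p)

theorem cups_mem_strands : ∀ p, cups δ N p ∈ strands δ N 0 (2 * p)
  | 0 => one_mem _
  | p + 1 => mul_mem (strands_mono le_rfl (by omega) (cups_mem_strands p))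
      (gen_mem_strands (by omega) (by omega))

theorem cups_commute {p n : ℕ} {y : TL δ N} (hy : y ∈ strands δ N (2 * p) n) :
    Commute (cups δ N p) y :=
  strands_commute le_rfl (cups_mem_strands p) hy

theorem star_cups : ∀ p, star (cups δ N p) = cups δ N p
  | 0 => star_one _
  | p + 1 => by
    rw [cups, star_mul, star_gen, star_cups p]
    exact (cups_commute (gen_mem_strands (n := 2 * p + 2) le_rfl (by omega))).symm.eq

theorem cups_mul_self : ∀ p, cups δ N p * cups δ N p = (δ : ℂ) ^ p • cups δ N p
  | 0 => by simp [cups]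
  | p + 1 => by
    have h := cups_commute (gen_mem_strands (δ := δ) (N := N) (i := 2 * p) (n := 2 * p + 2) le_rfl
      (by omega))
    calc cups δ N (p + 1) * cups δ N (p + 1)
        = cups δ N p * (gen δ N (2 * p) * cups δ N p) * gen δ N (2 * p) := by
          simp only [cups, mul_assoc]
      _ = (cups δ N p * cups δ N p) * (gen δ N (2 * p) * gen δ N (2 * p)) := by
          rw [← h.eq]; simp only [mul_assoc]
      _ = _ := by
          rw [cups_mul_self p, gen_mul_self, smul_mul_smul_comm, pow_succ, cups]

theorem cupProj_mul_star (hU : ∀ m, quantumInt δ (m + 1) ≠ 0) {p n : ℕ} :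
    cupProj δ N p n * star (cupProj δ N p n) = (δ : ℂ) ^ p • cupProj δ N p n := by
  have h := cups_commute (jw_mem_strands (δ := δ) (N := N) (2 * p) (n - 2 * p))
  rw [cupProj, star_mul, star_cups, star_jw]
  calc _ = cups δ N p * (jw δ N (2 * p) (n - 2 * p) * jw δ N (2 * p) (n - 2 * p)) *
        cups δ N p := by simp only [mul_assoc]
    _ = _ := by rw [jw_mul_self hU, mul_assoc, ← h.eq, ← mul_assoc, cups_mul_self, smul_mul_assoc]

theorem delta_ne_zero (hU : ∀ m, quantumInt δ (m + 1) ≠ 0) : (δ : ℂ) ≠ 0 := by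
  have := hU 1
  simpa [quantumInt] using this

variable {F : TL δ N →ₗ[ℂ] ℂ}

/-- Write δ g = g² and move one g around the trace: it then encloses x* y x, which compresses to two
fewer strands, while g becomes the (p+1)-st cup. -/
theorem trace_sandwich (hF : ∀ a b, F (a * b) = F (b * a)) {p n : ℕ} {x y z : TL δ N}
    (hx : x ∈ strands δ N (2 * p) n)
    (hz : gen δ N (2 * p) * (star x * y * x) * gen δ N (2 * p) = gen δ N (2 * p) * z) :
    (δ : ℂ) * F (cups δ N p * (y * (x * gen δ N (2 * p) * star x))) =
      F (cups δ N (p + 1) * z) := by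
  have h1 : Commute (cups δ N p) (gen δ N (2 * p)) :=
    cups_commute (gen_mem_strands (n := 2 * p + 2) le_rfl (by omega))
  have h2 := cups_commute (star_mem_strands hx)
  set g := gen δ N (2 * p) with hg
  set E := cups δ N p
  calc (δ : ℂ) * F (E * (y * (x * g * star x)))
      = F (E * y * x * g * (g * star x)) := by
        rw [← smul_eq_mul, ← map_smul]
        congr 1
        calc _ = E * (y * (x * ((δ : ℂ) • g) * star x)) := by
              simp only [mul_smul_comm, smul_mul_assoc]
          _ = _ := by rw [hg, ← gen_mul_self]; simp only [mul_assoc]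
    _ = F ((g * star x) * (E * y * x * g)) := hF _ _
    _ = F (E * (g * (star x * y * x) * g)) := by
        congr 1
        calc g * star x * (E * y * x * g) = g * (star x * E) * (y * x * g) := by
              simp only [mul_assoc]
          _ = (g * E) * (star x * y * x * g) := by rw [← h2.eq]; simp only [mul_assoc]
          _ = _ := by rw [← h1.eq]; simp only [mul_assoc]
    _ = _ := by rw [hz, cups, ← mul_assoc]

/-- Inserting the resolution of 1 after y leaves a multiple of `cupProj`, on which F vanishes, and
terms that `trace_sandwich` reduces to one more cup and two fewer free strands. This one criterion
later gives existence of coefficients as well as compatibility of functionals on different numbers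
of strands. -/
theorem trace_eq_zero (hU : ∀ m, quantumInt δ (m + 1) ≠ 0) (hF : ∀ a b, F (a * b) = F (b * a)) {n : ℕ}
    (h0 : ∀ p, 2 * p ≤ n → F (cupProj δ N p n) = 0) {y : TL δ N} (hy : y ∈ strands δ N 0 n) :
    F y = 0 := by
  have key : ∀ d p, 2 * p ≤ n → n ≤ 2 * p + d → ∀ y ∈ strands δ N (2 * p) n,
      F (cups δ N p * y) = 0 := by
    intro d
    induction d using Nat.strong_induction_on with
    | _ d ih =>
    intro p hp hd y hy
    have hn : 2 * p + (n - 2 * p) = n := Nat.add_sub_cancel' hp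
    obtain ⟨c, hc⟩ := exists_mul_jw hU (k := n - 2 * p) (by rwa [hn])
    conv_lhs => rw [← mul_one y, ← jw_add_sum (2 * p) (n - 2 * p), mul_add, mul_add, hc,
      mul_smul_comm, Finset.mul_sum, Finset.mul_sum]
    rw [map_add, map_smul, ← cupProj, h0 p hp, smul_zero, zero_add, map_sum]
    refine Finset.sum_eq_zero fun l hl => ?_
    rw [Finset.mem_range] at hl
    have hx := resElt_mem_strands (δ := δ) (N := N) (a := 2 * p) (l := l) (m := n) (by omega)
    obtain ⟨z, hz, hz'⟩ := compress n (2 * p) _ (mul_mem (mul_mem (star_mem_strands hx) hy) hx)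
    have h1 := trace_sandwich hF hx hz'
    rw [ih (d - 2) (by omega) (p + 1) (by omega) (by omega) z hz] at h1
    rw [mul_smul_comm, mul_smul_comm, map_smul, (mul_eq_zero_iff_left (delta_ne_zero hU)).1 h1,
      smul_zero]
  have := key n 0 (by omega) (by omega) y hy
  rwa [cups, one_mul] at this

/-- Apply the resolution of 1 on the left of y g. Its projection term vanishes: the projection
absorbs y up to a scalar and then meets g, which it kills as soon as k ≥ 2. -/
theorem exists_expansion (hU : ∀ m, quantumInt δ (m + 1) ≠ 0) {a k : ℕ} (hk : 2 ≤ k) {y : TL δ N}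
    (hy : y ∈ strands δ N a (a + k)) : ∃ z : ℕ → TL δ N, (∀ m, z m ∈ strands δ N (a + 2) (a + k)) ∧
      (∀ m, m + 1 < k → gen δ N a * (star (resElt δ N a m) * y) * gen δ N a = gen δ N a * z m) ∧
      y * gen δ N a = ∑ m ∈ Finset.range (k - 1),
        (ratio δ m : ℂ) • (resElt δ N a m * gen δ N a * z m) := by
  have h : ∀ m, ∃ z ∈ strands δ N (a + 2) (a + k), m + 1 < k →
      gen δ N a * (star (resElt δ N a m) * y) * gen δ N a = gen δ N a * z := by
    intro m
    by_cases hm : m + 1 < k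
    · obtain ⟨z, h1, h2⟩ := compress (a + k) a _
        (mul_mem (star_mem_strands (resElt_mem_strands (δ := δ) (N := N) (a := a) (l := m)
          (m := a + k) (by omega))) hy)
      exact ⟨z, h1, fun _ => h2⟩
    · exact ⟨0, zero_mem _, fun h => absurd h hm⟩
  choose z h1 h2 using h
  refine ⟨z, h1, h2, ?_⟩
  obtain ⟨c, hc⟩ := exists_jw_mul hU hy
  conv_lhs => rw [← one_mul (y * gen δ N a), ← jw_add_sum a k, add_mul, ← mul_assoc, hc,
    smul_mul_assoc, jw_mul_gen hU le_rfl (by omega), smul_zero, zero_add, Finset.sum_mul]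
  refine Finset.sum_congr rfl fun m hm => ?_
  rw [Finset.mem_range] at hm
  rw [smul_mul_assoc, mul_assoc (resElt δ N a m) _ (z m), ← h2 m (by omega)]
  simp only [mul_assoc]

/-- Resolving 1 repeatedly turns F(y y*) into a sum of squares with positive weights. The induction
is over the number of free strands next to p cups. Definiteness is carried along in the form `cups p
* y = 0`, which for p = 0 is y = 0. -/
theorem trace_mul_star (hU : ∀ m, quantumInt δ (m + 1) ≠ 0) (hδ : 0 < δ) (hr : ∀ m, 0 < ratio δ m)
    (hF : ∀ a b, F (a * b) = F (b * a)) {n : ℕ}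
    (h0 : ∀ p, 2 * p ≤ n → 0 < F (cupProj δ N p n)) {y : TL δ N} (hy : y ∈ strands δ N 0 n) :
    0 ≤ F (y * star y) ∧ (F (y * star y) = 0 → y = 0) := by
  have key : ∀ d p, 2 * p ≤ n → n ≤ 2 * p + d → ∀ y ∈ strands δ N (2 * p) n,
      0 ≤ F (cups δ N p * (y * star y)) ∧
        (F (cups δ N p * (y * star y)) = 0 → cups δ N p * y = 0) := by
    intro d
    induction d using Nat.strong_induction_on with
    | _ d ih =>
    intro p hp hd y hy
    obtain ⟨k, rfl⟩ := Nat.exists_eq_add_of_le hp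
    have hk : 2 * p + k - 2 * p = k := by omega
    obtain ⟨c, hc⟩ := exists_mul_jw hU hy
    have hexp : ∀ l, ∃ z : ℕ → TL δ N, l + 1 < k →
        (∀ m, z m ∈ strands δ N (2 * p + 2) (2 * p + k)) ∧
        (∀ m, m + 1 < k → gen δ N (2 * p) * (star (resElt δ N (2 * p) m) *
          (y * resElt δ N (2 * p) l)) * gen δ N (2 * p) = gen δ N (2 * p) * z m) ∧
        y * resElt δ N (2 * p) l * gen δ N (2 * p) = ∑ m ∈ Finset.range (k - 1),
          (ratio δ m : ℂ) • (resElt δ N (2 * p) m * gen δ N (2 * p) * z m) := by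
      intro l
      by_cases hl : l + 1 < k
      · obtain ⟨z, hz⟩ := exists_expansion hU (by omega)
          (mul_mem hy (resElt_mem_strands (δ := δ) (N := N) (a := 2 * p) (l := l)
          (m := 2 * p + k) (by omega)))
        exact ⟨z, fun _ => hz⟩
      · exact ⟨0, fun h => absurd h hl⟩
    choose z hz using hexp
    have hz1 := fun l hl => (hz l hl).1
    have hz2 := fun l hl => (hz l hl).2.1
    have hz3 := fun l hl => (hz l hl).2.2
    clear hz
    -- Insert the resolution of 1 between y and y*; the projection acts through the scalar c.
    have h1 : y * star y = (c * star c) • jw δ N (2 * p) k + ∑ l ∈ Finset.range (k - 1),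
        (ratio δ l : ℂ) • ((y * resElt δ N (2 * p) l) * gen δ N (2 * p) *
          star (y * resElt δ N (2 * p) l)) := by
      have h2 : y * jw δ N (2 * p) k * star y = (c * star c) • jw δ N (2 * p) k := by
        calc y * jw δ N (2 * p) k * star y
            = y * jw δ N (2 * p) k * star (y * jw δ N (2 * p) k) := by
              rw [star_mul, star_jw, mul_assoc, mul_assoc, ← mul_assoc (jw δ N (2 * p) k),
                jw_mul_self hU]
          _ = _ := by rw [hc, star_smul, star_jw, smul_mul_smul_comm, jw_mul_self hU]
      rw [← h2]
      conv_lhs => lhs; rw [← mul_one y, ← jw_add_sum (2 * p) k, mul_add, Finset.mul_sum]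
      rw [add_mul, Finset.sum_mul]
      congr 1
      refine Finset.sum_congr rfl fun l _ => ?_
      rw [mul_smul_comm, smul_mul_assoc, star_mul]
      simp only [mul_assoc]
    -- A second resolution, applied to y x_l g, splits the compressed element x* x into the squares
    -- z* z.
    have hterm : ∀ l, l + 1 < k → (δ : ℂ) * F (cups δ N p * ((y * resElt δ N (2 * p) l) *
        gen δ N (2 * p) * star (y * resElt δ N (2 * p) l))) = ∑ m ∈ Finset.range (k - 1),
          (ratio δ m : ℂ) * F (cups δ N (p + 1) * (star (z l m) * z l m)) := by
      intro l hl
      have hx := mul_mem hy (resElt_mem_strands (δ := δ) (N := N) (a := 2 * p) (l := l)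
          (m := 2 * p + k) (by omega))
      have h3 := trace_sandwich (y := 1) (z := ∑ m ∈ Finset.range (k - 1),
          (ratio δ m : ℂ) • (star (z l m) * z l m)) hF hx (by
        rw [mul_one, mul_assoc, mul_assoc, hz3 l hl, Finset.mul_sum, Finset.mul_sum,
          Finset.mul_sum]
        refine Finset.sum_congr rfl fun m hm => ?_
        rw [Finset.mem_range] at hm
        simp only [mul_smul_comm]
        congr 1
        have h4 := congrArg star (hz2 l hl m (by omega))
        simp only [star_mul, star_gen, star_star] at h4
        have h5 := gen_commute_strands (δ := δ) (N := N) le_rfl (star_mem_strands (hz1 l hl m))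
        rw [← mul_assoc (gen δ N (2 * p)) (star (z l m)), h5.eq, ← h4]
        simp only [star_mul, mul_assoc])
      rw [one_mul] at h3
      rw [h3, Finset.mul_sum, map_sum]
      refine Finset.sum_congr rfl fun m _ => ?_
      rw [mul_smul_comm, map_smul, smul_eq_mul]
    have h2 : F (cups δ N p * (y * star y)) = (c * star c) * F (cupProj δ N p (2 * p + k)) +
        ∑ l ∈ Finset.range (k - 1), (ratio δ l : ℂ) * (((δ⁻¹ : ℝ) : ℂ) *
          ∑ m ∈ Finset.range (k - 1),
          (ratio δ m : ℂ) * F (cups δ N (p + 1) * (star (z l m) * z l m))) := by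
      rw [h1, mul_add, map_add, mul_smul_comm, map_smul, smul_eq_mul, cupProj, hk, Finset.mul_sum,
        map_sum]
      congr 1
      refine Finset.sum_congr rfl fun l hl => ?_
      rw [Finset.mem_range] at hl
      rw [mul_smul_comm, map_smul, smul_eq_mul, ← hterm l (by omega), ← mul_assoc ((δ⁻¹ : ℝ) : ℂ),
        ← Complex.ofReal_mul, inv_mul_cancel₀ hδ.ne', Complex.ofReal_one, one_mul]
    have hpos : ∀ l m, l + 1 < k → 0 ≤ F (cups δ N (p + 1) * (star (z l m) * z l m)) ∧
        (F (cups δ N (p + 1) * (star (z l m) * z l m)) = 0 → cups δ N (p + 1) * z l m = 0) := by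
      intro l m hl
      -- The induction hypothesis concerns y y*, whereas the sandwich produced z* z; hence it is
      -- applied to z*.
      have h3 := star_mem_strands (hz1 l hl m)
      have h4 := ih (d - 2) (by omega) (p + 1) (by omega) (by omega) _ h3
      rw [star_star] at h4
      refine ⟨h4.1, fun h => ?_⟩
      have h5 := congrArg star (h4.2 h)
      rwa [star_mul, star_star, star_cups, star_zero,
        ← (cups_commute (p := p + 1) (hz1 l hl m)).eq] at h5
    have hrC : ∀ m, (0 : ℂ) < (ratio δ m : ℂ) := fun m => by exact_mod_cast hr m
    have hδC : (0 : ℂ) < ((δ⁻¹ : ℝ) : ℂ) := by exact_mod_cast inv_pos.2 hδ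
    have hin : ∀ l ∈ Finset.range (k - 1), ∀ m ∈ Finset.range (k - 1),
        0 ≤ (ratio δ m : ℂ) * F (cups δ N (p + 1) * (star (z l m) * z l m)) := fun l hl m _ =>
      mul_nonneg (hrC m).le (hpos l m (by rw [Finset.mem_range] at hl; omega)).1
    have hout : ∀ l ∈ Finset.range (k - 1), 0 ≤ (ratio δ l : ℂ) * (((δ⁻¹ : ℝ) : ℂ) *
          ∑ m ∈ Finset.range (k - 1),
          (ratio δ m : ℂ) * F (cups δ N (p + 1) * (star (z l m) * z l m))) := fun l hl =>
      mul_nonneg (hrC l).le (mul_nonneg hδC.le (Finset.sum_nonneg (hin l hl)))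
    have hc0 : 0 ≤ c * star c := mul_star_self_nonneg c
    have hcP := mul_nonneg hc0 (h0 p hp).le
    rw [h2]
    refine ⟨add_nonneg hcP (Finset.sum_nonneg hout), fun h => ?_⟩
    rw [add_eq_zero_iff_of_nonneg hcP (Finset.sum_nonneg hout),
      Finset.sum_eq_zero_iff_of_nonneg hout] at h
    have hc1 : c = 0 := by
      have := (mul_eq_zero.1 h.1).resolve_right (h0 p hp).ne'
      simpa using this
    -- Vanishing forces c = 0 and `cups (p + 1) * z l m = 0` for all l, m. Expanding y by both
    -- resolutions, every term of `cups p * y` contains one of these products.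
    conv_lhs => rw [← mul_one y, ← jw_add_sum (2 * p) k, mul_add, hc, hc1, zero_smul, zero_add,
      Finset.mul_sum, Finset.mul_sum]
    refine Finset.sum_eq_zero fun l hl => ?_
    have h3 := h.2 l hl
    rw [mul_eq_zero_iff_left (hrC l).ne', mul_eq_zero_iff_left hδC.ne',
      Finset.sum_eq_zero_iff_of_nonneg (hin l hl)] at h3
    have hl' : l + 1 < k := by rw [Finset.mem_range] at hl; omega
    rw [mul_smul_comm, ← mul_assoc y, ← mul_assoc y, hz3 l hl', Finset.sum_mul, mul_smul_comm,
      Finset.mul_sum, Finset.sum_eq_zero, smul_zero]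
    intro m hm
    have h4 := (hpos l m hl').2 ((mul_eq_zero_iff_left (hrC m).ne').1 (h3 m hm))
    have h5 : cups δ N p * resElt δ N (2 * p) m = resElt δ N (2 * p) m * cups δ N p :=
      (cups_commute (resElt_mem_strands (m := 2 * p + k)
        (by rw [Finset.mem_range] at hm; omega))).eq
    have h6 : cups δ N p * (resElt δ N (2 * p) m * gen δ N (2 * p) * z l m *
        star (resElt δ N (2 * p) l)) =
        resElt δ N (2 * p) m * (cups δ N (p + 1) * z l m) * star (resElt δ N (2 * p) l) := by
      calc _ = (cups δ N p * resElt δ N (2 * p) m) * (gen δ N (2 * p) * z l m *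
            star (resElt δ N (2 * p) l)) := by simp only [mul_assoc]
        _ = _ := by rw [h5]; simp only [cups, mul_assoc]
    rw [smul_mul_assoc, mul_smul_comm, h6, h4]
    simp
  have := key n 0 (by omega) (by omega) y hy
  rwa [cups, one_mul, one_mul] at this

/-! ## The recursion for the values at `cupProj` -/

/-- The product `g_a g_{a+1} ⋯ g_{a+l}`. -/
def ascend (δ : ℝ) (N : ℕ∞) (a : ℕ) : ℕ → TL δ N
  | 0 => gen δ N a
  | l + 1 => ascend δ N a l * gen δ N (a + l + 1)

theorem ascend_mem_strands (a : ℕ) : ∀ l, ascend δ N a l ∈ strands δ N a (a + l + 2)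
  | 0 => gen_mem_strands le_rfl (by omega)
  | l + 1 => mul_mem (strands_mono le_rfl (by omega) (ascend_mem_strands a l))
      (gen_mem_strands (by omega) (by omega))

theorem star_ascend_mul_ascend (a : ℕ) :
    ∀ l, star (ascend δ N a l) * ascend δ N a l = (δ : ℂ) • gen δ N (a + l)
  | 0 => by simp [ascend, star_gen, gen_mul_self]
  | l + 1 => by
    calc star (ascend δ N a (l + 1)) * ascend δ N a (l + 1)
        = gen δ N (a + l + 1) * (star (ascend δ N a l) * ascend δ N a l) * gen δ N (a + l + 1) := by
          simp only [ascend, star_mul, star_gen, mul_assoc]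
      _ = _ := by
        rw [star_ascend_mul_ascend a l, mul_smul_comm, smul_mul_assoc, gen_succ_jones]; rfl

theorem ascend_jones (a l : ℕ) (h : ((a + l + 1 : ℕ) : ℕ∞) + 1 < N) :
    ascend δ N a l * gen δ N (a + l + 1) * gen δ N (a + l) = ascend δ N a l := by
  cases l with
  | zero => exact gen_jones a h
  | succ l =>
    calc _ = ascend δ N a l * (gen δ N (a + l + 1) * gen δ N (a + l + 1 + 1) *
          gen δ N (a + l + 1)) := by
          simp only [ascend, mul_assoc]; rfl
      _ = _ := by rw [gen_jones (a + l + 1) h, ascend]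

theorem index_lt {i j : ℕ} (hij : i ≤ j) (h : (j : ℕ∞) + 1 < N) : (i : ℕ∞) + 1 < N :=
  lt_of_le_of_lt (by gcongr) h

theorem ascend_mul_gen_mul_star (a : ℕ) : ∀ l, ((a + l + 1 : ℕ) : ℕ∞) + 1 < N →
    ascend δ N a l * gen δ N (a + l + 1) * star (ascend δ N a l) = gen δ N a
  | 0, h => by
    rw [ascend, star_gen]
    exact gen_jones a h
  | l + 1, h => by
    calc _ = ascend δ N a l * (gen δ N (a + l + 1) * gen δ N (a + l + 1 + 1) *
          gen δ N (a + l + 1)) * star (ascend δ N a l) := by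
          simp only [ascend, star_mul, star_gen, mul_assoc]; rfl
      _ = _ := by rw [gen_jones (a + l + 1) h, ascend_mul_gen_mul_star a l (index_lt (by omega) h)]

theorem ascend_mul_star (a l : ℕ) (h : ((a + l : ℕ) : ℕ∞) + 1 < N) :
    ascend δ N a l * star (ascend δ N a l) = (δ : ℂ) • gen δ N a := by
  cases l with
  | zero => simp [ascend, star_gen, gen_mul_self]
  | succ l =>
    calc _ = ascend δ N a l * (gen δ N (a + l + 1) * gen δ N (a + l + 1)) *
          star (ascend δ N a l) := by
          simp only [ascend, star_mul, star_gen, mul_assoc]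
      _ = _ := by
        rw [gen_mul_self, mul_smul_comm, smul_mul_assoc, ascend_mul_gen_mul_star a l h]

/-- Diagrammatically, `ascend` has a cup at its left end, a cap at its right end, and in between
strands shifted by two; a generator sliding along them changes its index by two. Hence a whole
projection can be shifted in `ascend_mul_jw`. -/
theorem ascend_mul_gen (a i l : ℕ) (hi : i + 2 ≤ l) (h : ((a + l : ℕ) : ℕ∞) + 1 < N) :
    ascend δ N a l * gen δ N (a + i) = gen δ N (a + 2 + i) * ascend δ N a l := by
  induction l, hi using Nat.le_induction with
  | base =>
    have h1 : Commute (ascend δ N a i) (gen δ N (a + i + 2)) :=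
      strands_commute le_rfl (ascend_mem_strands a i)
        (gen_mem_strands (n := a + i + 4) le_rfl (by omega))
    have h2 : gen δ N (a + i + 2) * gen δ N (a + i) = gen δ N (a + i) * gen δ N (a + i + 2) :=
      gen_comm (by omega)
    calc ascend δ N a (i + 2) * gen δ N (a + i)
        = ascend δ N a i * gen δ N (a + i + 1) * (gen δ N (a + i + 2) * gen δ N (a + i)) := by
          simp only [ascend, mul_assoc]; rfl
      _ = (ascend δ N a i * gen δ N (a + i + 1) * gen δ N (a + i)) * gen δ N (a + i + 2) := by
          rw [h2]; simp only [mul_assoc]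
      _ = ascend δ N a i * gen δ N (a + i + 2) := by rw [ascend_jones a i (index_lt (by omega) h)]
      _ = ascend δ N a i * (gen δ N (a + i + 2) * gen δ N (a + i + 1) * gen δ N (a + i + 2)) := by
          rw [gen_succ_jones (a + i + 1)]
      _ = gen δ N (a + i + 2) * ascend δ N a i * gen δ N (a + i + 1) * gen δ N (a + i + 2) := by
          rw [← h1.eq]; simp only [mul_assoc]
      _ = _ := by rw [show a + 2 + i = a + i + 2 by omega]; simp only [ascend, mul_assoc]; rfl
  | succ l hl ih =>
    have h2 : gen δ N (a + l + 1) * gen δ N (a + i) = gen δ N (a + i) * gen δ N (a + l + 1) :=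
      gen_comm (by omega)
    rw [ascend, mul_assoc, h2, ← mul_assoc, ih (index_lt (by omega) h), mul_assoc]

theorem ascend_mul_jw (a l : ℕ) (h : ((a + l : ℕ) : ℕ∞) + 1 < N) :
    ∀ m, m ≤ l → ascend δ N a l * jw δ N a m = jw δ N (a + 2) m * ascend δ N a l
  | 0, _ => by simp [jw]
  | 1, _ => by simp [jw]
  | m + 2, hm => by
    have h1 := ascend_mul_jw a l h (m + 1) (by omega)
    have h2 := ascend_mul_gen (δ := δ) a m l hm h
    rw [jw_succ_succ, jw_succ_succ, mul_sub, sub_mul, h1, mul_smul_comm, smul_mul_assoc]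
    congr 2
    rw [← mul_assoc, ← mul_assoc, h1, mul_assoc (jw δ N (a + 2) (m + 1)), h2, ← mul_assoc, mul_assoc,
      h1, ← mul_assoc]

theorem trace_cupProj_top (p : ℕ) :
    F (cupProj δ N p (2 * p)) = F (cupProj δ N p (2 * p + 1)) := by
  simp [cupProj, jw]

/-- The recursion for the projection gives a correction term containing P g P. Under the trace it
becomes g P g, and `sandwich` cancels the factor `ratio δ m`, leaving the smaller projection with a
cup at its right end. Conjugation by `ascend` carries this cup to the left end, where it joins the
other p. -/
theorem trace_cupProj_recursion (hU : ∀ m, quantumInt δ (m + 1) ≠ 0)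
    (hF : ∀ a b, F (a * b) = F (b * a)) {p n : ℕ} (hp : 2 * p < n) (hn : ((n + 1 : ℕ) : ℕ∞) ≤ N) :
    F (cupProj δ N p n) = F (cupProj δ N p (n + 1)) +
      (δ : ℂ)⁻¹ * F (cupProj δ N (p + 1) (n + 1)) := by
  obtain ⟨m, rfl⟩ : ∃ m, n = 2 * p + m + 1 := ⟨n - 2 * p - 1, by omega⟩
  have hN : ((2 * p + m : ℕ) : ℕ∞) + 1 < N := lt_of_lt_of_le (by norm_cast; omega) hn
  have hδ := delta_ne_zero hU
  obtain ⟨h1, h2, h3, h4⟩ := isJW (N := N) hU (2 * p) m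
  rw [cupProj, cupProj, cupProj, show 2 * p + m + 1 - 2 * p = m + 1 by omega,
    show 2 * p + m + 1 + 1 - 2 * p = m + 2 by omega,
    show 2 * p + m + 1 + 1 - 2 * (p + 1) = m by omega, jw_succ_succ, cups,
    show 2 * (p + 1) = 2 * p + 2 by ring]
  have hr : ((quantumInt δ (m + 2) / quantumInt δ (m + 1) : ℝ) : ℂ) * (ratio δ m : ℂ) = 1 := by
    have := hU m
    have := hU (m + 1)
    rw [← Complex.ofReal_mul, ratio]
    norm_cast
    field_simp
  have hEg : Commute (cups δ N p) (gen δ N (2 * p + m)) :=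
    cups_commute (gen_mem_strands (n := 2 * p + m + 2) (by omega) (by omega))
  have hEP : Commute (cups δ N p) (jw δ N (2 * p) (m + 1)) := cups_commute (jw_mem_strands _ _)
  have hEV : Commute (cups δ N p) (ascend δ N (2 * p) m) := cups_commute (ascend_mem_strands _ _)
  have hsq := gen_mul_self (δ := δ) (N := N) (2 * p + m)
  have hV1 := star_ascend_mul_ascend (δ := δ) (N := N) (2 * p) m
  have hV2 := ascend_mul_star (δ := δ) (N := N) (2 * p) m hN
  have hV3 := ascend_mul_jw (δ := δ) (N := N) (2 * p) m hN m le_rfl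
  have hVg : Commute (jw δ N (2 * p + 2) m) (gen δ N (2 * p)) :=
    (gen_commute_strands le_rfl (jw_mem_strands _ _)).symm
  set E := cups δ N p
  set P := jw δ N (2 * p) (m + 1)
  set P0 := jw δ N (2 * p) m
  set P2 := jw δ N (2 * p + 2) m
  set g := gen δ N (2 * p + m)
  set V := ascend δ N (2 * p) m
  have e1 : F (E * (P * g * P)) = F (E * P * g) := by
    calc F (E * (P * g * P)) = F ((E * P * g) * P) := by simp only [mul_assoc]
      _ = F (P * (E * P * g)) := hF _ _
      _ = F (E * (P * P) * g) := by rw [← mul_assoc, ← mul_assoc, ← hEP.eq]; simp only [mul_assoc]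
      _ = _ := by rw [h1]
  have e2 : (δ : ℂ) * F (E * P * g) = F (E * (g * P * g)) := by
    calc (δ : ℂ) * F (E * P * g) = F (E * P * g * g) := by
          rw [mul_assoc, mul_assoc, mul_assoc, hsq, mul_smul_comm, mul_smul_comm, map_smul,
            smul_eq_mul]
      _ = F (g * (E * P * g)) := hF _ _
      _ = _ := by rw [← mul_assoc, ← mul_assoc, ← hEg.eq]; simp only [mul_assoc]
  -- δ g and δ g_{2p} are V* V and V V*, so cyclicity exchanges them, and passing V shifts `P0` to
  -- `P2`.
  have e3 : (δ : ℂ) * F (E * (P0 * g)) = (δ : ℂ) * F (E * gen δ N (2 * p) * P2) := by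
    calc (δ : ℂ) * F (E * (P0 * g)) = F (E * P0 * star V * V) := by
          rw [mul_assoc, hV1, mul_smul_comm, map_smul, smul_eq_mul, mul_assoc]
      _ = F (V * (E * P0 * star V)) := hF _ _
      _ = F (E * (V * P0) * star V) := by
          rw [← mul_assoc, ← mul_assoc, ← hEV.eq]; simp only [mul_assoc]
      _ = F (E * (P2 * (V * star V))) := by rw [hV3]; simp only [mul_assoc]
      _ = _ := by
        rw [hV2, mul_smul_comm, mul_smul_comm, map_smul, smul_eq_mul, hVg.eq, mul_assoc]
  have e3' := mul_left_cancel₀ hδ e3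
  rw [h4, mul_smul_comm, map_smul, smul_eq_mul, e3'] at e2
  rw [mul_sub, map_sub, mul_smul_comm, map_smul, smul_eq_mul, e1]
  have : (ratio δ m : ℂ) * F (E * P * g) = (δ : ℂ)⁻¹ * F (E * gen δ N (2 * p) * P2) := by
    field_simp
    linear_combination (ratio δ m : ℂ) * e2 + F (E * gen δ N (2 * p) * P2) * hr
  rw [this]
  ring

/-! ## The values of the standard traces at `cupProj` -/

section StdTrace

variable {n p j : ℕ}

theorem stdTrace_mul_comm (a b : TL δ n) : stdTrace δ n j (a * b) = stdTrace δ n j (b * a) := by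
  simp only [stdTrace, LinearMap.comp_apply, AlgHom.toLinearMap_apply, map_mul]
  exact LinearMap.trace_mul_comm ℂ _ _

theorem stdTrace_eq_sum [Fintype (LinkState n j)] (x : TL δ n) :
    stdTrace δ n j x = ∑ s, standardRep δ n j x (Finsupp.single s 1) s := by
  classical
  rw [stdTrace, LinearMap.comp_apply, LinearMap.trace_eq_matrix_trace ℂ Finsupp.basisSingleOne,
    Matrix.trace]
  refine Finset.sum_congr rfl fun s _ => ?_
  rw [Matrix.diag_apply, LinearMap.toMatrix_apply]
  simp

/-- The generator with index `i`. -/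
def mkGen (i : ℕ) (h : i + 1 < n) : Gen n := ⟨i, by exact_mod_cast h⟩

theorem standardRep_gen {i : ℕ} (h : i + 1 < n) :
    standardRep δ n j (gen δ n i) = genAct δ (mkGen i h) := by
  rw [show gen δ n i = e (mkGen i h) from dif_pos (by exact_mod_cast h)]
  exact lift_e _ _ _ _ _

/-- The first `2p` points are joined to their neighbours in `p` cups. -/
def Paired (p : ℕ) (s : LinkState n j) : Prop :=
  ∀ x : Fin n, (x : ℕ) < 2 * p → (s.partner x : ℕ) = if (x : ℕ) % 2 = 0 then (x : ℕ) + 1 else x - 1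

theorem step_eq_self {i : Gen n} {s : LinkState n j} (h : s.partner (fstPt i) = sndPt i) :
    step i s = s ∧ weight δ i s = δ := by
  have hk : ¬Kills i s := fun hk => fstPt_ne_sndPt i (by rw [← h]; exact hk.1.symm)
  refine ⟨LinkState.ext ?_, by simp [weight, mergeWeight, h]⟩
  rw [step_partner hk]
  have h2 := s.invol
  have h3 := fstPt_ne_sndPt i
  funext x
  unfold mergeFun
  grind

theorem genAct_of_cup {i : Gen n} {s : LinkState n j} (h : s.partner (fstPt i) = sndPt i) (c : ℂ) :
    genAct δ i (Finsupp.single s c) = (δ : ℂ) • Finsupp.single s c := by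
  rw [genAct_single, (step_eq_self (δ := δ) h).1, (step_eq_self h).2, Finsupp.smul_single,
    smul_eq_mul, mul_comm]

theorem cups_succ (p : ℕ) : cups δ N (p + 1) = gen δ N (2 * p) * cups δ N p :=
  (cups_commute (gen_mem_strands (n := 2 * p + 2) le_rfl (by omega))).eq

theorem Paired.succ_of_step {i : Gen n} (hi : i.1 = 2 * p) {s : LinkState n j} (hs : Paired p s)
    (h : ¬Kills i s) : Paired (p + 1) (step i s) := by
  intro x hx
  rw [step_partner h]
  have e1 : (fstPt i : ℕ) = 2 * p := hi
  have e2 : (sndPt i : ℕ) = 2 * p + 1 := by rw [← hi]; rfl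
  by_cases h1 : x = fstPt i
  · subst h1
    simp [mergeFun, e1, e2]
  by_cases h2 : x = sndPt i
  · subst h2
    simp only [mergeFun, h1, if_true, if_false]
    rw [e1, e2]
    split_ifs <;> omega
  have h3 : (x : ℕ) ≠ 2 * p := fun h => h1 (Fin.ext (by omega))
  have h4 : (x : ℕ) ≠ 2 * p + 1 := fun h => h2 (Fin.ext (by omega))
  have hx' : (x : ℕ) < 2 * p := by omega
  have h5 := hs x hx'
  have h6 : x ≠ s.partner (fstPt i) := by
    rintro rfl
    rw [s.invol] at h5
    split_ifs at h5 <;> omega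
  have h7 : x ≠ s.partner (sndPt i) := by
    rintro rfl
    rw [s.invol] at h5
    split_ifs at h5 <;> omega
  simp only [mergeFun, h1, h2, h6, h7, if_false]
  exact h5

theorem exists_cups_single (hp : 2 * p ≤ n) (s : LinkState n j) :
    ∃ (s' : LinkState n j) (c : ℂ), standardRep δ n j (cups δ n p) (Finsupp.single s 1) =
      Finsupp.single s' c ∧ (c ≠ 0 → Paired p s') := by
  induction p with
  | zero => exact ⟨s, 1, by simp [cups], fun _ x hx => absurd hx (by omega)⟩
  | succ p ih =>
    obtain ⟨s', c, h1, h2⟩ := ih (by omega)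
    have hN : 2 * p + 1 < n := by omega
    rw [cups_succ, map_mul, Module.End.mul_apply, h1, standardRep_gen hN, genAct_single]
    refine ⟨_, _, rfl, fun h => ?_⟩
    have h3 : ¬Kills (mkGen (2 * p) hN) s' := fun hk => by simp [weight_kills hk] at h
    exact (h2 (left_ne_zero_of_mul h)).succ_of_step rfl h3

theorem cups_single_of_paired (hp : 2 * p ≤ n) {s : LinkState n j} (hs : Paired p s) :
    standardRep δ n j (cups δ n p) (Finsupp.single s 1) = (δ : ℂ) ^ p • Finsupp.single s 1 := by
  induction p with
  | zero => simp [cups]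
  | succ p ih =>
    have hN : 2 * p + 1 < n := by omega
    rw [cups_succ, map_mul, Module.End.mul_apply, ih (by omega) fun x hx => hs x (by omega),
      map_smul, standardRep_gen hN, genAct_of_cup, smul_smul, pow_succ]
    refine Fin.ext ?_
    rw [hs _ (by simp [fstPt, mkGen])]
    simp [fstPt, sndPt, mkGen]

theorem card_ge (hp : 2 * p ≤ n) : (Finset.univ.filter fun x : Fin n => 2 * p ≤ (x : ℕ)).card =
    n - 2 * p := by
  have h := Fin.card_filter_val_lt (n := n) (m := 2 * p)
  have h2 := Finset.card_filter_add_card_filter_not (s := (Finset.univ : Finset (Fin n)))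
    (fun x => (x : ℕ) < 2 * p)
  simp only [not_lt, Finset.card_univ, Fintype.card_fin] at h2
  rw [h] at h2
  have : min n (2 * p) = 2 * p := min_eq_right hp
  omega

theorem Paired.fixed_subset {s : LinkState n j} (hs : Paired p s) :
    (Finset.univ.filter fun x => s.partner x = x) ⊆
      Finset.univ.filter fun x : Fin n => 2 * p ≤ (x : ℕ) := by
  intro x hx
  simp only [Finset.mem_filter, Finset.mem_univ, true_and] at hx ⊢
  by_contra! h
  have := hs x h
  rw [hx] at this
  split_ifs at this <;> omega

theorem Paired.le (hp : 2 * p ≤ n) {s : LinkState n j} (hs : Paired p s) : p ≤ j := by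
  have h1 := Finset.card_le_card hs.fixed_subset
  rw [card_ge hp] at h1
  have := s.card_through
  omega

theorem Paired.partner_eq_self (hp : 2 * p ≤ n) {s : LinkState n p} (hs : Paired p s) (x : Fin n)
    (hx : 2 * p ≤ (x : ℕ)) : s.partner x = x := by
  have h1 := Finset.eq_of_subset_of_card_le hs.fixed_subset (by
    rw [card_ge hp]; have := s.card_through; omega)
  have : x ∈ Finset.univ.filter fun x => s.partner x = x := by
    rw [h1]; simpa using hx
  simpa using this

theorem Paired.eq (hp : 2 * p ≤ n) {s s' : LinkState n p} (hs : Paired p s) (hs' : Paired p s') :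
    s = s' := by
  refine LinkState.ext (funext fun x => Fin.ext ?_)
  by_cases h : (x : ℕ) < 2 * p
  · rw [hs x h, hs' x h]
  · rw [hs.partner_eq_self hp x (by omega), hs'.partner_eq_self hp x (by omega)]

/-- The point just inside a cup starts a strictly narrower cup, by non-crossing, so descent on the
width ends at an innermost one. -/
theorem LinkState.exists_adjacent (s : LinkState n j) (x : Fin n) (hx : x < s.partner x) :
    ∃ k : Fin n, x ≤ k ∧ (s.partner k : ℕ) = k + 1 := by
  generalize hd : (s.partner x : ℕ) - x = d
  induction d using Nat.strong_induction_on generalizing x with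
  | _ d ih =>
  by_cases h : (s.partner x : ℕ) = x + 1
  · exact ⟨x, le_rfl, h⟩
  have hlt : (x : ℕ) < s.partner x := hx
  have hb := (s.partner x).2
  let y : Fin n := ⟨x + 1, by omega⟩
  have hxy : x < y := Fin.lt_def.2 (by simp [y])
  obtain ⟨h1, h2, h3⟩ := s.noncrossing x y hxy (Fin.lt_def.2 (by simp only [y]; omega))
  rw [Fin.lt_def] at h2 h3
  have h4 : (s.partner y : ℕ) ≠ x + 1 := fun h => h1 (Fin.ext h)
  have hy : (y : ℕ) = x + 1 := rfl
  clear_value y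
  obtain ⟨k, hk1, hk2⟩ := ih _ (by omega) y (Fin.lt_def.2 (by omega)) rfl
  exact ⟨k, hxy.le.trans hk1, hk2⟩

theorem Paired.exists_adjacent (hp : 2 * p ≤ n) (hpj : p < j) {s : LinkState n j}
    (hs : Paired p s) : ∃ k : Fin n, 2 * p ≤ (k : ℕ) ∧ (s.partner k : ℕ) = k + 1 := by
  obtain ⟨x, hx, hx'⟩ : ∃ x : Fin n, 2 * p ≤ (x : ℕ) ∧ s.partner x ≠ x := by
    by_contra! h
    have h1 : (Finset.univ.filter fun x : Fin n => 2 * p ≤ (x : ℕ)) ⊆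
        Finset.univ.filter fun x => s.partner x = x := by
      intro x hx
      simp only [Finset.mem_filter, Finset.mem_univ, true_and] at hx ⊢
      exact h x hx
    have h2 := Finset.card_le_card h1
    rw [card_ge hp] at h2
    have := s.card_through
    omega
  have hy : 2 * p ≤ (s.partner x : ℕ) := by
    by_contra! h
    have h1 := hs _ h
    rw [s.invol] at h1
    split_ifs at h1 <;> omega
  rcases lt_or_gt_of_ne hx' with h | h
  · obtain ⟨k, h1, h2⟩ := s.exists_adjacent (s.partner x) (by rwa [s.invol])
    exact ⟨k, hy.trans (Fin.le_def.1 h1), h2⟩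
  · obtain ⟨k, h1, h2⟩ := s.exists_adjacent x h
    exact ⟨k, hx.trans (Fin.le_def.1 h1), h2⟩

/-- The generator at an adjacent cup multiplies the state by δ ≠ 0, yet the projection kills that
generator. -/
theorem jw_single_eq_zero (hU : ∀ m, quantumInt δ (m + 1) ≠ 0) {s : LinkState n j} {k : Fin n}
    (hk : 2 * p ≤ (k : ℕ)) (h : (s.partner k : ℕ) = k + 1) (c : ℂ) :
    standardRep δ n j (jw δ n (2 * p) (n - 2 * p)) (Finsupp.single s c) = 0 := by
  have hb := (s.partner k).2
  have hN : (k : ℕ) + 1 < n := by omega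
  have h1 := genAct_of_cup (δ := δ) (i := mkGen k hN) (s := s) (Fin.ext h) c
  rw [← standardRep_gen] at h1
  have h2 := congrArg (standardRep δ n j (jw δ n (2 * p) (n - 2 * p))) h1
  rw [← Module.End.mul_apply, ← map_mul, jw_mul_gen hU hk (by omega), map_zero,
    LinearMap.zero_apply, map_smul] at h2
  exact (smul_eq_zero.1 h2.symm).resolve_left (delta_ne_zero hU)

/-- All points under the projection carry through strands, so every correction term in the recursion
would join two of them and acts by 0. -/
theorem jw_single_eq_self {s : LinkState n p} (hp : 2 * p ≤ n) (hs : Paired p s) (c : ℂ) :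
    ∀ k, 2 * p + k ≤ n →
      standardRep δ n p (jw δ n (2 * p) k) (Finsupp.single s c) = Finsupp.single s c
  | 0, _ => by simp [jw]
  | 1, _ => by simp [jw]
  | k + 2, hk => by
    have hN : 2 * p + k + 1 < n := by omega
    have h1 := jw_single_eq_self hp hs c (k + 1) (by omega)
    have h2 : Kills (mkGen (2 * p + k) hN) s :=
      ⟨hs.partner_eq_self hp _ (by simp [fstPt, mkGen]),
        hs.partner_eq_self hp _ (by simp [sndPt, mkGen]; omega)⟩
    rw [jw_succ_succ, map_sub, map_smul, map_mul, map_mul, LinearMap.sub_apply,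
      LinearMap.smul_apply, Module.End.mul_apply, Module.End.mul_apply, h1, standardRep_gen hN,
      genAct_single, weight_kills h2]
    simp

/-- The involution of the link state with `p` cups on the first `2p` points. -/
def pairedPartner (hp : 2 * p ≤ n) (x : Fin n) : Fin n :=
  ⟨if (x : ℕ) < 2 * p then (if (x : ℕ) % 2 = 0 then (x : ℕ) + 1 else x - 1) else x, by
    split_ifs <;> omega⟩

theorem val_pairedPartner (hp : 2 * p ≤ n) (x : Fin n) : (pairedPartner hp x : ℕ) =
    if (x : ℕ) < 2 * p then (if (x : ℕ) % 2 = 0 then (x : ℕ) + 1 else x - 1) else x := rfl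

/-- The link state with `p` cups on the first `2p` points. -/
def pairedState (hp : 2 * p ≤ n) : LinkState n p where
  partner := pairedPartner hp
  invol x := by
    refine Fin.ext ?_
    simp only [val_pairedPartner]
    split_ifs <;> omega
  noncrossing x y hxy hyx := by
    rw [Fin.lt_def] at hxy hyx
    rw [val_pairedPartner] at hyx
    split_ifs at hyx <;> omega
  card_through := by
    rw [show (Finset.univ.filter fun x : Fin n => pairedPartner hp x = x)
      = Finset.univ.filter fun x : Fin n => 2 * p ≤ (x : ℕ) from Finset.filter_congr fun x _ => by
        rw [Fin.ext_iff, val_pairedPartner]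
        split_ifs <;> omega, card_ge hp]
    omega

theorem paired_pairedState (hp : 2 * p ≤ n) : Paired p (pairedState hp) := by
  intro x hx
  change (pairedPartner hp x : ℕ) = _
  rw [val_pairedPartner, if_pos hx]

theorem cupProj_eq_mul : cupProj δ N p n = jw δ N (2 * p) (n - 2 * p) * cups δ N p :=
  (cups_commute (jw_mem_strands _ _)).eq

/-- After the cups have acted, a surviving state has its first 2p points paired, which needs p ≤ j.
If p < j, there is a further adjacent cup among the remaining points, and the projection kills it.
-/
theorem stdTrace_cupProj_of_ne (hU : ∀ m, quantumInt δ (m + 1) ≠ 0) (hp : 2 * p ≤ n)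
    (h : j ≠ p) : stdTrace δ n j (cupProj δ n p n) = 0 := by
  classical
  have := Fintype.ofFinite (LinkState n j)
  rw [stdTrace_eq_sum]
  refine Finset.sum_eq_zero fun s _ => ?_
  obtain ⟨s', c, h1, h2⟩ := exists_cups_single (δ := δ) hp s
  rw [cupProj_eq_mul, map_mul, Module.End.mul_apply, h1]
  by_cases hc : c = 0
  · simp [hc]
  · have h3 := (h2 hc).le hp
    obtain ⟨k, hk1, hk2⟩ := (h2 hc).exists_adjacent hp (lt_of_le_of_ne h3 h.symm)
    rw [jw_single_eq_zero hU hk1 hk2, Finsupp.zero_apply]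

/-- Every state is sent to a multiple of the unique paired one, so that state gives the only
diagonal entry. -/
theorem stdTrace_cupProj_self (hp : 2 * p ≤ n) :
    stdTrace δ n p (cupProj δ n p n) = (δ : ℂ) ^ p := by
  classical
  have := Fintype.ofFinite (LinkState n p)
  rw [stdTrace_eq_sum, Finset.sum_eq_single (pairedState hp)]
  · rw [cupProj_eq_mul, map_mul, Module.End.mul_apply,
      cups_single_of_paired hp (paired_pairedState hp), map_smul,
      jw_single_eq_self hp (paired_pairedState hp) _ _ (by omega)]
    simp
  · intro s _ hs
    obtain ⟨s', c, h1, h2⟩ := exists_cups_single (δ := δ) hp s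
    rw [cupProj_eq_mul, map_mul, Module.End.mul_apply, h1]
    by_cases hc : c = 0
    · simp [hc]
    · rw [jw_single_eq_self hp (h2 hc) _ _ (by omega), Finsupp.single_apply, if_neg]
      rintro rfl
      exact hs ((h2 hc).eq hp (paired_pairedState hp))
  · simp

end StdTrace

/-! ## Inclusions between the algebras -/

theorem algHom_ext {A : Type*} [Ring A] [Algebra ℂ A] {f g : TL δ N →ₐ[ℂ] A}
    (h : ∀ i, f (e i) = g (e i)) : f = g := by
  ext x
  induction x using induction with
  | hc c => rw [AlgHom.commutes, AlgHom.commutes]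
  | he i => exact h i
  | hm a b h1 h2 => rw [map_mul, map_mul, h1, h2]
  | ha a b h1 h2 => rw [map_add, map_add, h1, h2]

/-- The standard homomorphism from the algebra on fewer strands to the one on more strands. -/
def incl {M N : ℕ∞} (h : M ≤ N) : TL δ M →ₐ[ℂ] TL δ N :=
  lift (fun i => e ⟨i.1, lt_of_lt_of_le i.2 h⟩) (fun _ => e_sq _)
    (fun _ _ h => e_jones _ _ h) (fun _ _ h => e_comm _ _ h)

theorem incl_e {M N : ℕ∞} (h : M ≤ N) (i : Gen M) :
    incl (δ := δ) h (e i) = e ⟨i.1, lt_of_lt_of_le i.2 h⟩ := lift_e _ _ _ _ _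

theorem incl_incl {L M N : ℕ∞} (h : L ≤ M) (h' : M ≤ N) (x : TL δ L) :
    incl h' (incl h x) = incl (h.trans h') x := by
  have : (incl h').comp (incl (δ := δ) h) = incl (h.trans h') := algHom_ext fun i => by
    rw [AlgHom.comp_apply, incl_e, incl_e]
    exact incl_e _ _
  exact DFunLike.congr_fun this x

theorem toInf_eq_incl (n : ℕ) : toInf δ n = incl le_top := rfl

theorem incl_self (h : N ≤ N) (x : TL δ N) : incl h x = x := by
  have : incl (δ := δ) h = AlgHom.id ℂ _ := algHom_ext fun i => by rw [incl_e]; rfl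
  rw [this, AlgHom.id_apply]

theorem incl_gen {M N : ℕ∞} (h : M ≤ N) {i : ℕ} (hi : (i : ℕ∞) + 1 < M) :
    incl h (gen δ M i) = gen δ N i := by
  rw [gen, dif_pos hi, gen, dif_pos (lt_of_lt_of_le hi h)]
  exact incl_e _ _

theorem incl_jw {M N : ℕ∞} (h : M ≤ N) (a : ℕ) :
    ∀ k, ((a + k : ℕ) : ℕ∞) ≤ M → incl h (jw δ M a k) = jw δ N a k
  | 0, _ => map_one _
  | 1, _ => map_one _
  | k + 2, hk => by
    have h1 : ((a + (k + 1) : ℕ) : ℕ∞) ≤ M := le_trans (by norm_cast; omega) hk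
    have h2 : ((a + k : ℕ) : ℕ∞) + 1 < M := lt_of_lt_of_le (by norm_cast; omega) hk
    rw [jw_succ_succ, jw_succ_succ, map_sub, map_smul, map_mul, map_mul, incl_jw h a (k + 1) h1,
      incl_gen h h2]

theorem incl_cups {M N : ℕ∞} (h : M ≤ N) :
    ∀ p, ((2 * p : ℕ) : ℕ∞) ≤ M → incl h (cups δ M p) = cups δ N p
  | 0, _ => map_one _
  | p + 1, hp => by
    have h1 : ((2 * p : ℕ) : ℕ∞) ≤ M := le_trans (by norm_cast; omega) hp
    have h2 : ((2 * p : ℕ) : ℕ∞) + 1 < M := lt_of_lt_of_le (by norm_cast; omega) hp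
    rw [cups, cups, map_mul, incl_cups h p h1, incl_gen h h2]

theorem incl_cupProj {M N : ℕ∞} (h : M ≤ N) {p n : ℕ} (hp : 2 * p ≤ n) (hn : (n : ℕ∞) ≤ M) :
    incl h (cupProj δ M p n) = cupProj δ N p n := by
  rw [cupProj, map_mul, incl_cups h p (le_trans (by exact_mod_cast hp) hn), incl_jw h, cupProj]
  rwa [Nat.add_sub_cancel' hp]

theorem exists_mem_strands (x : TL δ N) : ∃ n : ℕ, (n : ℕ∞) ≤ N ∧ x ∈ strands δ N 0 n := by
  induction x using induction with
  | hc c => exact ⟨0, by simp, Subalgebra.algebraMap_mem _ _⟩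
  | he i =>
    refine ⟨i.1 + 2, ?_, ?_⟩
    · have := Order.add_one_le_of_lt i.2
      rwa [add_assoc, one_add_one_eq_two] at this
    · have := gen_mem_strands (δ := δ) (N := N) (n := i.1 + 2) (Nat.zero_le i.1) (by omega)
      rwa [gen, dif_pos i.2] at this
  | hm a b h1 h2 =>
    obtain ⟨n, hn, h1⟩ := h1
    obtain ⟨m, hm, h2⟩ := h2
    exact ⟨max n m, by rcases max_choice n m with h | h <;> rw [h] <;> assumption,
      mul_mem (strands_mono le_rfl (le_max_left _ _) h1)
        (strands_mono le_rfl (le_max_right _ _) h2)⟩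
  | ha a b h1 h2 =>
    obtain ⟨n, hn, h1⟩ := h1
    obtain ⟨m, hm, h2⟩ := h2
    exact ⟨max n m, by rcases max_choice n m with h | h <;> rw [h] <;> assumption,
      add_mem (strands_mono le_rfl (le_max_left _ _) h1)
        (strands_mono le_rfl (le_max_right _ _) h2)⟩

theorem mem_strands_nat {n : ℕ} (x : TL δ n) : x ∈ strands δ n 0 n := by
  obtain ⟨m, hm, h⟩ := exists_mem_strands x
  exact strands_mono le_rfl (by exact_mod_cast hm) h

theorem exists_toInf_of_mem {n : ℕ} {x : TL δ ⊤} (hx : x ∈ strands δ ⊤ 0 n) :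
    ∃ y, toInf δ n y = x := by
  refine strands_induction (p := fun x => ∃ y, toInf δ n y = x) (fun i _ h => ?_) (fun c => ?_)
    ?_ ?_ hx
  · exact ⟨gen δ n i, incl_gen le_top (by exact_mod_cast h)⟩
  · exact ⟨algebraMap ℂ _ c, AlgHom.commutes _ _⟩
  · rintro _ _ ⟨a, rfl⟩ ⟨b, rfl⟩
    exact ⟨a + b, map_add _ _ _⟩
  · rintro _ _ ⟨a, rfl⟩ ⟨b, rfl⟩
    exact ⟨a * b, map_mul _ _ _⟩

theorem exists_toInf_pair (x y : TL δ ⊤) : ∃ n a b, toInf δ n a = x ∧ toInf δ n b = y := by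
  obtain ⟨n, -, h1⟩ := exists_mem_strands x
  obtain ⟨m, -, h2⟩ := exists_mem_strands y
  obtain ⟨a, ha⟩ := exists_toInf_of_mem (strands_mono le_rfl (le_max_left n m) h1)
  obtain ⟨b, hb⟩ := exists_toInf_of_mem (strands_mono le_rfl (le_max_right n m) h2)
  exact ⟨_, a, b, ha, hb⟩

/-! ## The union as a direct limit -/

theorem natCast_mono {m n : ℕ} (h : m ≤ n) : (m : ℕ∞) ≤ (n : ℕ∞) := by exact_mod_cast h

theorem toInf_incl {m n : ℕ} (h : (m : ℕ∞) ≤ (n : ℕ∞)) (x : TL δ m) :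
    toInf δ n (incl h x) = toInf δ m x := incl_incl h le_top x

/-- Eventual equality of sequences of elements of the algebras on finitely many strands. -/
def germCon (δ : ℝ) : RingCon (∀ n : ℕ, TL δ n) where
  r x y := ∀ᶠ n in Filter.atTop, x n = y n
  iseqv := ⟨fun _ => Filter.Eventually.of_forall fun _ => rfl,
    fun h => h.mono fun _ => Eq.symm, fun h h' => (h.and h').mono fun _ h => h.1.trans h.2⟩
  mul' h h' := (h.and h').mono fun n h => by rw [Pi.mul_apply, Pi.mul_apply, h.1, h.2]
  add' h h' := (h.and h').mono fun n h => by rw [Pi.add_apply, Pi.add_apply, h.1, h.2]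

theorem germ_eq {x y : ∀ n : ℕ, TL δ n} :
    (x : (germCon δ).Quotient) = y ↔ ∀ᶠ n in Filter.atTop, x n = y n :=
  (germCon δ).eq

/-- The map from the infinite algebra to germs of sequences. -/
def toGerm (δ : ℝ) : TL δ ⊤ →ₐ[ℂ] (germCon δ).Quotient :=
  lift (fun i => ((fun n => gen δ n i.1 : ∀ n : ℕ, TL δ n) : (germCon δ).Quotient))
    (fun i => by
      rw [← RingCon.coe_mul, ← RingCon.coe_smul, germ_eq]
      exact Filter.Eventually.of_forall fun n => gen_mul_self _)
    (fun i j h => by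
      rw [← RingCon.coe_mul, ← RingCon.coe_mul, germ_eq]
      rcases h with h | h
      · exact Filter.Eventually.of_forall fun n => by
          simp only [Pi.mul_apply, h]
          exact gen_succ_jones _
      -- On i + 2 strands the middle generator is 0 although the outer one exists. The relation
      -- therefore has to be imposed only eventually, which is why germs are used.
      · filter_upwards [Filter.eventually_ge_atTop (i.1 + 3)] with n hn
        simp only [Pi.mul_apply, h]
        exact gen_jones _ (by norm_cast))
    (fun i j h => by
      rw [← RingCon.coe_mul, ← RingCon.coe_mul, germ_eq]
      exact Filter.Eventually.of_forall fun n => gen_comm h)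

theorem toGerm_toInf {n : ℕ} (y : TL δ n) : ∃ s : ∀ m : ℕ, TL δ m,
    toGerm δ (toInf δ n y) = (s : (germCon δ).Quotient) ∧
      ∀ᶠ m in Filter.atTop, ∃ h : n ≤ m, s m = incl (natCast_mono h) y := by
  induction y using induction with
  | hc c =>
    refine ⟨fun m => algebraMap ℂ _ c, ?_, ?_⟩
    · rw [AlgHom.commutes, AlgHom.commutes]; rfl
    · filter_upwards [Filter.eventually_ge_atTop n] with m hm
      exact ⟨hm, (AlgHom.commutes _ _).symm⟩
  | he i =>
    refine ⟨fun m => gen δ m i.1, ?_, ?_⟩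
    · rw [toInf_eq_incl, incl_e]
      exact lift_e _ _ _ _ _
    · filter_upwards [Filter.eventually_ge_atTop n] with m hm
      refine ⟨hm, ?_⟩
      rw [incl_e, gen, dif_pos (lt_of_lt_of_le i.2 (natCast_mono hm))]
  | hm a b h1 h2 =>
    obtain ⟨s, h1, h1'⟩ := h1
    obtain ⟨s', h2, h2'⟩ := h2
    refine ⟨s * s', by rw [map_mul, map_mul, h1, h2, RingCon.coe_mul], ?_⟩
    filter_upwards [h1', h2'] with m h1 h2
    obtain ⟨h, h1⟩ := h1
    obtain ⟨_, h2⟩ := h2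
    exact ⟨h, by rw [map_mul, ← h1, ← h2, Pi.mul_apply]⟩
  | ha a b h1 h2 =>
    obtain ⟨s, h1, h1'⟩ := h1
    obtain ⟨s', h2, h2'⟩ := h2
    refine ⟨s + s', by rw [map_add, map_add, h1, h2, RingCon.coe_add], ?_⟩
    filter_upwards [h1', h2'] with m h1 h2
    obtain ⟨h, h1⟩ := h1
    obtain ⟨_, h2⟩ := h2
    exact ⟨h, by rw [map_add, ← h1, ← h2, Pi.add_apply]⟩

/-- Injectivity of TL_n → TL_∞ is not needed: the map to germs shows that equality in the limit
already holds at a finite stage, which suffices for gluing. -/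
theorem exists_incl_eq {n : ℕ} {y z : TL δ n} (h : toInf δ n y = toInf δ n z) :
    ∃ m, ∃ hm : n ≤ m, incl (natCast_mono hm) y = incl (natCast_mono hm) z := by
  obtain ⟨s, h1, h1'⟩ := toGerm_toInf y
  obtain ⟨s', h2, h2'⟩ := toGerm_toInf z
  rw [h, h2, germ_eq] at h1
  obtain ⟨m, h1, ⟨hm, h2⟩, ⟨_, h3⟩⟩ := (h1.and (h1'.and h2')).exists
  exact ⟨m, hm, by rw [← h2, ← h3, h1]⟩

theorem exists_glue (f : ∀ n : ℕ, TL δ n →ₗ[ℂ] ℂ)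
    (hf : ∀ n x, f (n + 1) (incl (natCast_mono n.le_succ) x) = f n x) :
    ∃ t : TL δ ⊤ →ₗ[ℂ] ℂ, ∀ n x, t (toInf δ n x) = f n x := by
  have h1 : ∀ n m (h : n ≤ m) x, f m (incl (natCast_mono h) x) = f n x := by
    intro n m h
    induction m, h using Nat.le_induction with
    | base => intro x; rw [incl_self]
    | succ m h ih => intro x; rw [← ih, ← hf m, incl_incl]
  have h2 : ∀ n y z, toInf δ n y = toInf δ n z → f n y = f n z := by
    intro n y z h
    obtain ⟨m, hm, h⟩ := exists_incl_eq h
    rw [← h1 n m hm, h, h1 n m hm]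
  have h3 : ∀ x : TL δ ⊤, ∃ n a, toInf δ n a = x := fun x => by
    obtain ⟨n, a, _, h, _⟩ := exists_toInf_pair x x
    exact ⟨n, a, h⟩
  choose n a h3 using h3
  have h4 : ∀ m b, f (n (toInf δ m b)) (a (toInf δ m b)) = f m b := by
    intro m b
    rw [← h1 _ (max (n (toInf δ m b)) m) (le_max_left _ _), ← h1 m _ (le_max_right _ _)]
    apply h2
    rw [toInf_incl, toInf_incl, h3]
  refine ⟨{ toFun := fun x => f (n x) (a x), map_add' := fun x y => ?_, map_smul' := fun c x => ?_ },
    h4⟩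
  · obtain ⟨m, b, b', rfl, rfl⟩ := exists_toInf_pair x y
    rw [← map_add, h4, h4, h4, map_add]
  · obtain ⟨m, b, _, rfl, _⟩ := exists_toInf_pair x x
    rw [← map_smul, h4, h4, map_smul, RingHom.id_apply]

/-! ## Coefficients of traces -/

/-- The coefficients of a trace. -/
def coeff (t : TL δ ⊤ →ₗ[ℂ] ℂ) (n i : ℕ) : ℂ := ((δ : ℂ) ^ i)⁻¹ * t (cupProj δ ⊤ i n)

theorem toInf_cupProj {n p : ℕ} (hp : 2 * p ≤ n) :
    toInf δ n (cupProj δ n p n) = cupProj δ ⊤ p n :=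
  incl_cupProj le_top hp le_rfl

theorem sum_stdTrace_cupProj (hU : ∀ m, quantumInt δ (m + 1) ≠ 0) {n p : ℕ} (hp : 2 * p ≤ n)
    (c : ℕ → ℂ) : ∑ i ∈ Finset.range (n / 2 + 1), c i * stdTrace δ n i (cupProj δ n p n) =
      c p * (δ : ℂ) ^ p := by
  rw [Finset.sum_eq_single p, stdTrace_cupProj_self hp]
  · intro i _ hi
    rw [stdTrace_cupProj_of_ne hU hp hi, mul_zero]
  · intro h
    rw [Finset.mem_range] at h
    omega

theorem HasCoeffs.eq_coeff (hU : ∀ m, quantumInt δ (m + 1) ≠ 0) {t : TL δ ⊤ →ₗ[ℂ] ℂ}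
    {c : ℕ → ℕ → ℂ} (h : HasCoeffs t c) {n i : ℕ} (hi : 2 * i ≤ n) : c n i = coeff t n i := by
  have := pow_ne_zero i (delta_ne_zero hU)
  rw [coeff, ← toInf_cupProj hi, h, sum_stdTrace_cupProj hU hi (c n)]
  field_simp

/-- The difference of the two sides is a trace on TL_n that vanishes at every `cupProj`, hence is
zero. -/
theorem hasCoeffs_coeff (hU : ∀ m, quantumInt δ (m + 1) ≠ 0) {t : TL δ ⊤ →ₗ[ℂ] ℂ}
    (ht : IsTrace t) : HasCoeffs t (coeff t) := by
  intro n x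
  let F : TL δ n →ₗ[ℂ] ℂ := t ∘ₗ (toInf δ n).toLinearMap -
    ∑ i ∈ Finset.range (n / 2 + 1), coeff t n i • stdTrace δ n i
  have hFx : ∀ x, F x = t (toInf δ n x) -
      ∑ i ∈ Finset.range (n / 2 + 1), coeff t n i * stdTrace δ n i x := fun x => by
    simp [F]
  have hF : ∀ a b, F (a * b) = F (b * a) := fun a b => by
    simp only [hFx, map_mul, ht (toInf δ n a), stdTrace_mul_comm a]
  have h0 : F x = 0 := by
    refine trace_eq_zero hU hF (fun p hp => ?_) (mem_strands_nat x)
    have := pow_ne_zero p (delta_ne_zero hU)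
    rw [hFx, sum_stdTrace_cupProj hU hp (coeff t n), toInf_cupProj hp, coeff]
    field_simp
    ring
  rw [hFx] at h0
  exact sub_eq_zero.1 h0

theorem HasCoeffs.congr {t : TL δ ⊤ →ₗ[ℂ] ℂ} {c c' : ℕ → ℕ → ℂ} (h : HasCoeffs t c)
    (hc : ∀ n i, 2 * i ≤ n → c' n i = c n i) : HasCoeffs t c' := by
  intro n x
  rw [h n x]
  refine Finset.sum_congr rfl fun i hi => ?_
  rw [Finset.mem_range] at hi
  rw [hc n i (by omega)]

theorem HasCoeffs.ext {t t' : TL δ ⊤ →ₗ[ℂ] ℂ} {c : ℕ → ℕ → ℂ} (h : HasCoeffs t c)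
    (h' : HasCoeffs t' c) : t = t' := by
  ext x
  obtain ⟨n, a, _, rfl, _⟩ := exists_toInf_pair x x
  rw [h, h']

theorem HasCoeffs.isTrace {t : TL δ ⊤ →ₗ[ℂ] ℂ} {c : ℕ → ℕ → ℂ} (h : HasCoeffs t c) :
    IsTrace t := by
  intro x y
  obtain ⟨n, a, b, rfl, rfl⟩ := exists_toInf_pair x y
  rw [← map_mul, ← map_mul, h, h]
  simp only [stdTrace_mul_comm a]

theorem coeff_zero_zero (t : TL δ ⊤ →ₗ[ℂ] ℂ) : coeff t 0 0 = t 1 := by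
  simp [coeff, cupProj, cups, jw]

/-- The compatibility of the coefficients on `n` and on `n + 1` strands. -/
structure IsHarmonic (c : ℕ → ℕ → ℂ) : Prop where
  top : ∀ p, c (2 * p) p = c (2 * p + 1) p
  add : ∀ n p, 2 * p < n → c n p = c (n + 1) p + c (n + 1) (p + 1)

theorem isHarmonic_coeff (hU : ∀ m, quantumInt δ (m + 1) ≠ 0) {t : TL δ ⊤ →ₗ[ℂ] ℂ}
    (ht : IsTrace t) : IsHarmonic (coeff t) := by
  refine ⟨fun p => by rw [coeff, coeff, trace_cupProj_top], fun n p hp => ?_⟩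
  rw [coeff, coeff, coeff, trace_cupProj_recursion hU ht hp le_top, pow_succ, mul_inv]
  ring

/-- The functionals prescribed on the TL_n are traces, so their compatibility need only be tested at
`cupProj`. There it is the recursion that defines harmonicity, and the functionals glue. -/
theorem IsHarmonic.exists_trace (hU : ∀ m, quantumInt δ (m + 1) ≠ 0) {c : ℕ → ℕ → ℂ}
    (hc : IsHarmonic c) : ∃ t : TL δ ⊤ →ₗ[ℂ] ℂ, HasCoeffs t c := by
  let f : ∀ n : ℕ, TL δ n →ₗ[ℂ] ℂ := fun n =>
    ∑ i ∈ Finset.range (n / 2 + 1), c n i • stdTrace δ n i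
  have hfx : ∀ n x, f n x = ∑ i ∈ Finset.range (n / 2 + 1), c n i * stdTrace δ n i x :=
    fun n x => by simp [f]
  have hf : ∀ n a b, f n (a * b) = f n (b * a) := fun n a b => by
    simp only [hfx, stdTrace_mul_comm a]
  have hfp : ∀ n p, 2 * p ≤ n → f n (cupProj δ n p n) = c n p * (δ : ℂ) ^ p := fun n p hp => by
    rw [hfx, sum_stdTrace_cupProj hU hp (c n)]
  obtain ⟨t, ht⟩ := exists_glue f (fun n x => by
    let F : TL δ n →ₗ[ℂ] ℂ := f (n + 1) ∘ₗ (incl (natCast_mono n.le_succ)).toLinearMap - f n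
    have hFx : ∀ x, F x = f (n + 1) (incl (natCast_mono n.le_succ) x) - f n x := fun x => rfl
    have h0 : F x = 0 := by
      refine trace_eq_zero hU (fun a b => ?_) (fun p hp => ?_) (mem_strands_nat x)
      · rw [hFx, hFx, map_mul (incl _), map_mul (incl _), hf n a, hf (n + 1)]
      · rw [hFx, incl_cupProj _ hp le_rfl, hfp n p hp]
        rcases hp.eq_or_lt with rfl | h
        · rw [trace_cupProj_top, hfp _ _ (by omega), hc.top, sub_self]
        · have := delta_ne_zero hU
          rw [trace_cupProj_recursion hU (hf (n + 1)) h le_rfl, hfp _ _ (by omega),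
            hfp _ _ (by omega), hc.add n p h, pow_succ]
          field_simp
          ring
    rw [hFx] at h0
    exact sub_eq_zero.1 h0)
  exact ⟨t, fun n x => by rw [ht, hfx]⟩

theorem isCoeffPositive_iff (hU : ∀ m, quantumInt δ (m + 1) ≠ 0) {t : TL δ ⊤ →ₗ[ℂ] ℂ}
    (ht : IsTrace t) : IsCoeffPositive t ↔ ∀ n i, 2 * i ≤ n → 0 < coeff t n i := by
  refine ⟨?_, fun h => ⟨_, hasCoeffs_coeff hU ht, h⟩⟩
  rintro ⟨c, hc, h⟩ n i hi
  rw [← hc.eq_coeff hU hi]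
  exact h n i hi

/-! ## Positive functionals on polynomials -/

section Functionals

open Polynomial

/-- The polynomials with `Q_{k+2} = Q_{k+1} - X Q_k`. -/
def walkPoly : ℕ → ℝ[X]
  | 0 => 1
  | 1 => 1
  | k + 2 => walkPoly (k + 1) - X * walkPoly k

/-- Functionals positive on all `X ^ i * walkPoly k`. -/
def IsWalkPositive (L : ℝ[X] →ₗ[ℝ] ℝ) : Prop := ∀ i k, 0 < L (X ^ i * walkPoly k)

/-- The normalized functionals positive on all `X ^ i * walkPoly k`. -/
def walkPositive : Set (ℝ[X] →ₗ[ℝ] ℝ) := {L | L 1 = 1 ∧ IsWalkPositive L}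

variable {L : ℝ[X] →ₗ[ℝ] ℝ}

theorem IsWalkPositive.smul_mul_X (hL : IsWalkPositive L) {c : ℝ} (hc : 0 < c) :
    IsWalkPositive (c • L ∘ₗ LinearMap.mulLeft ℝ X) := fun i k => by
  have := hL (i + 1) k
  rw [pow_succ', mul_assoc] at this
  simpa using mul_pos hc this

theorem one_sub_X_mul_walkPoly (k : ℕ) :
    (1 - X) * walkPoly (k + 2) = walkPoly (k + 3) + X ^ 2 * walkPoly k := by
  simp only [walkPoly]
  ring

/-- The products (1 − X) Q_k are again sums of polynomials X^i Q_l: Q_2 for k = 0, 1, and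
`one_sub_X_mul_walkPoly` beyond. -/
theorem IsWalkPositive.smul_mul_one_sub_X (hL : IsWalkPositive L) {c : ℝ} (hc : 0 < c) :
    IsWalkPositive (c • L ∘ₗ LinearMap.mulLeft ℝ (1 - X)) := fun i k => by
  suffices h : 0 < L (X ^ i * ((1 - X) * walkPoly k)) by
    rw [mul_left_comm] at h
    simpa using mul_pos hc h
  match k with
  | 0 => simpa [walkPoly] using hL i 2
  | 1 => simpa [walkPoly] using hL i 2
  | k + 2 =>
    rw [one_sub_X_mul_walkPoly, mul_add, map_add, ← mul_assoc, ← pow_add]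
    exact add_pos (hL _ _) (hL _ _)

theorem IsWalkPositive.pow_mul_pow (hL : IsWalkPositive L) (a b : ℕ) :
    0 < L (X ^ a * (1 - X) ^ b) := by
  induction b generalizing L with
  | zero => simpa [walkPoly] using hL a 0
  | succ b ih =>
    have := ih (hL.smul_mul_one_sub_X one_pos)
    rw [pow_succ', mul_left_comm]
    simpa using this

/-- The second moment of a binomial variable about nγ, which is its variance plus its squared bias.
-/
theorem sum_bernstein (n : ℕ) (γ : ℝ) :
    ∑ ν ∈ Finset.range (n + 1), C (((ν : ℝ) - n * γ) ^ 2) * bernsteinPolynomial ℝ n ν =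
      C (n : ℝ) * (X * (1 - X)) + C ((n : ℝ) ^ 2) * (X - C γ) ^ 2 := by
  have h1 := bernsteinPolynomial.sum ℝ n
  have h2 := bernsteinPolynomial.sum_smul ℝ n
  have h3 := bernsteinPolynomial.variance ℝ n
  have h4 : ∀ ν ∈ Finset.range (n + 1), C (((ν : ℝ) - n * γ) ^ 2) * bernsteinPolynomial ℝ n ν =
      (n • X - (ν : ℝ[X])) ^ 2 * bernsteinPolynomial ℝ n ν +
      (C (n : ℝ) ^ 2 * (X - C γ) ^ 2 - 2 * C (n : ℝ) ^ 2 * (X - C γ) * X) *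
        bernsteinPolynomial ℝ n ν +
      2 * C (n : ℝ) * (X - C γ) * (ν • bernsteinPolynomial ℝ n ν) := fun ν _ => by
    simp only [nsmul_eq_mul, map_pow, map_sub, map_mul, map_natCast]
    ring
  rw [Finset.sum_congr rfl h4, Finset.sum_add_distrib, Finset.sum_add_distrib, ← Finset.mul_sum,
    ← Finset.mul_sum, h1, h2, h3]
  simp only [nsmul_eq_mul, map_pow, map_natCast]
  ring

/-- L is positive on X^a (1 − X)^b, hence nonnegative on X^m times the sum in `sum_bernstein`. In
the resulting inequality the n² term dominates for large n. This replaces a representing measure on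
[0, 1]. -/
theorem IsWalkPositive.sq_nonneg (hL : IsWalkPositive L) (m : ℕ) (γ : ℝ) :
    0 ≤ L (X ^ m * (X - C γ) ^ 2) := by
  have h : ∀ n : ℕ, 0 ≤ n * L (X ^ m * (X * (1 - X))) + n ^ 2 * L (X ^ m * (X - C γ) ^ 2) := by
    intro n
    have h1 : L (X ^ m * ∑ ν ∈ Finset.range (n + 1),
        C (((ν : ℝ) - n * γ) ^ 2) * bernsteinPolynomial ℝ n ν) =
        n * L (X ^ m * (X * (1 - X))) + n ^ 2 * L (X ^ m * (X - C γ) ^ 2) := by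
      rw [sum_bernstein, mul_add, map_add, ← smul_eq_C_mul, ← smul_eq_C_mul, mul_smul_comm,
        mul_smul_comm, map_smul, map_smul, smul_eq_mul, smul_eq_mul]
    rw [← h1, Finset.mul_sum, map_sum]
    refine Finset.sum_nonneg fun ν _ => ?_
    rw [mul_left_comm, ← smul_eq_C_mul, map_smul, smul_eq_mul, bernsteinPolynomial,
      show X ^ m * ((n.choose ν : ℝ[X]) * X ^ ν * (1 - X) ^ (n - ν)) =
        C (n.choose ν : ℝ) * (X ^ (m + ν) * (1 - X) ^ (n - ν)) by
        rw [map_natCast]; ring, ← smul_eq_C_mul, map_smul, smul_eq_mul]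
    have := (hL.pow_mul_pow (m + ν) (n - ν)).le
    positivity
  by_contra! hneg
  obtain ⟨n, hn⟩ := exists_nat_gt (L (X ^ m * (X * (1 - X))) / -L (X ^ m * (X - C γ) ^ 2))
  rw [div_lt_iff₀ (by linarith)] at hn
  have hA : 0 < L (X ^ m * (X * (1 - X))) := by
    have := hL.pow_mul_pow (m + 1) 1
    rwa [pow_succ, pow_one, mul_assoc] at this
  have hn0 : (0 : ℝ) < n := by
    rcases Nat.eq_zero_or_pos n with rfl | h
    · simp at hn; linarith
    · exact_mod_cast h
  have := h n
  nlinarith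

/-! ### Evaluation functionals and extreme points. -/

theorem functional_ext {L L' : ℝ[X] →ₗ[ℝ] ℝ} (h : ∀ m : ℕ, L (X ^ m) = L' (X ^ m)) : L = L' := by
  ext m
  simpa [← X_pow_eq_monomial] using h m

theorem leval_pow (γ : ℝ) (m : ℕ) : leval γ (X ^ m) = γ ^ m := by simp [leval_apply]

/-- The ratios of successive values satisfy r ↦ 1 − γ/r. At γ = 1/4 this map has the fixed point
1/2, so the bound r ≥ 1/2 propagates. -/
theorem half_eval_walkPoly_le {γ : ℝ} (h2 : γ ≤ 1 / 4) (k : ℕ) :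
    0 < (walkPoly k).eval γ ∧ (walkPoly k).eval γ / 2 ≤ (walkPoly (k + 1)).eval γ := by
  induction k with
  | zero => norm_num [walkPoly]
  | succ k ih =>
    have h3 : (walkPoly (k + 2)).eval γ =
        (walkPoly (k + 1)).eval γ - γ * (walkPoly k).eval γ := by simp [walkPoly]
    rw [show k + 1 + 1 = k + 2 from rfl, h3]
    have := mul_le_mul_of_nonneg_right h2 ih.1.le
    constructor <;> linarith

theorem leval_mem_walkPositive {γ : ℝ} (hγ : γ ∈ Set.Ioc (0 : ℝ) (1 / 4)) :
    leval γ ∈ walkPositive := by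
  refine ⟨by simp [leval_apply], fun i k => ?_⟩
  have := (half_eval_walkPoly_le hγ.2 k).1
  have := hγ.1
  simp only [leval_apply, eval_mul, eval_pow, eval_X]
  positivity

/-- The ratios obey r ↦ 1 − γ/r and stay in (0, 1]. Since r + 1/(4r) ≥ 1, each step lowers them by
at least γ − 1/4, so γ > 1/4 would make them negative eventually. -/
theorem le_quarter_of_eval_walkPoly_pos {γ : ℝ} (h : ∀ k, 0 < (walkPoly k).eval γ) (h0 : 0 < γ) :
    γ ≤ 1 / 4 := by
  by_contra! h4
  set r : ℕ → ℝ := fun k => (walkPoly (k + 1)).eval γ / (walkPoly k).eval γ with hr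
  have hpos : ∀ k, 0 < r k := fun k => div_pos (h _) (h _)
  have hrec : ∀ k, r (k + 1) = 1 - γ / r k := fun k => by
    have h1 := (h k).ne'
    have h2 := (h (k + 1)).ne'
    have h3 : (walkPoly (k + 2)).eval γ =
        (walkPoly (k + 1)).eval γ - γ * (walkPoly k).eval γ := by simp [walkPoly]
    simp only [hr]
    rw [show k + 1 + 1 = k + 2 from rfl, h3]
    field_simp
  have hle : ∀ k, r k ≤ 1 := fun k => by
    cases k with
    | zero => simp [hr, walkPoly]
    | succ k => rw [hrec]; have := div_pos h0 (hpos k); linarith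
  have hstep : ∀ k, r (k + 1) ≤ r k - (γ - 1 / 4) := fun k => by
    have h1 := hpos k
    have h2 : (γ - 1 / 4) ≤ (γ - 1 / 4) / r k := by
      rw [le_div_iff₀ h1]
      have := hle k
      nlinarith
    have h3 : 1 - r k ≤ (1 / 4) / r k := by
      rw [le_div_iff₀ h1]
      nlinarith [_root_.sq_nonneg (r k - 1 / 2)]
    rw [hrec]
    have h5 : γ / r k = (γ - 1 / 4) / r k + (1 / 4) / r k := by ring
    linarith
  have hlin : ∀ k : ℕ, r k ≤ 1 - k * (γ - 1 / 4) := fun k => by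
    induction k with
    | zero => simpa using hle 0
    | succ k ih =>
      push_cast
      linarith [hstep k]
  obtain ⟨k, hk⟩ := exists_nat_gt (1 / (γ - 1 / 4))
  rw [div_lt_iff₀ (by linarith)] at hk
  linarith [hlin k, hpos k]

theorem exists_leval_of_extreme (hL : L ∈ walkPositive.extremePoints ℝ) :
    ∃ γ ∈ Set.Ioc (0 : ℝ) (1 / 4), L = leval γ := by
  obtain ⟨⟨h1, hpos⟩, hext⟩ := mem_extremePoints.1 hL
  have hX : 0 < L X := by simpa [walkPoly] using hpos 1 0
  have hX' : 0 < L (1 - X) := by simpa using hpos.pow_mul_pow 0 1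
  -- L is the convex combination, with weights L(X) and L(1 − X), of the normalized functionals f ↦
  -- L(Xf) and f ↦ L((1 − X)f); extremality equates the first with L.
  have h2 := hext ((L X)⁻¹ • L ∘ₗ LinearMap.mulLeft ℝ X)
    ⟨by simp [hX.ne'], hpos.smul_mul_X (inv_pos.2 hX)⟩
    ((L (1 - X))⁻¹ • L ∘ₗ LinearMap.mulLeft ℝ (1 - X))
    ⟨by simp only [LinearMap.smul_apply, LinearMap.comp_apply, LinearMap.mulLeft_apply, mul_one,
          smul_eq_mul]; exact inv_mul_cancel₀ hX'.ne', hpos.smul_mul_one_sub_X (inv_pos.2 hX')⟩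
    ⟨L X, L (1 - X), hX, hX', by rw [← map_add]; simpa using h1, by
      rw [smul_smul, smul_smul, mul_inv_cancel₀ hX.ne', mul_inv_cancel₀ hX'.ne', one_smul, one_smul,
        ← LinearMap.comp_add]
      ext m
      simp [sub_mul]⟩
  have h3 : ∀ f, L (X * f) = L X * L f := fun f => by
    have := LinearMap.congr_fun h2.1 f
    simp only [LinearMap.smul_apply, LinearMap.comp_apply, LinearMap.mulLeft_apply,
      smul_eq_mul] at this
    rw [← this, mul_inv_cancel_left₀ hX.ne']
  have h4 : L = leval (L X) := functional_ext fun m => by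
    rw [leval_pow]
    induction m with
    | zero => simpa using h1
    | succ m ih => rw [pow_succ', h3, ih, pow_succ']
  refine ⟨L X, ⟨hX, le_quarter_of_eval_walkPoly_pos (fun k => ?_) hX⟩, h4⟩
  have := hpos 0 k
  rw [h4] at this
  simpa [leval_apply] using this

/-- Evaluation at γ kills X^m (X − γ)², on which both summands are nonnegative, so L kills it too.
The moments of L thus satisfy a recursion with double root γ. -/
theorem eq_leval_of_convex_combination {L' : ℝ[X] →ₗ[ℝ] ℝ} (hL : L ∈ walkPositive)
    (hL' : L' ∈ walkPositive) {γ a b : ℝ} (hγ : 0 < γ) (ha : 0 < a) (hb : 0 < b)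
    (h : a • L + b • L' = leval γ) : L = leval γ := by
  have hval : ∀ f, a * L f + b * L' f = f.eval γ := fun f => LinearMap.congr_fun h f
  have hsq : ∀ m, L (X ^ m * (X - C γ) ^ 2) = 0 := fun m => by
    have h1 := hval (X ^ m * (X - C γ) ^ 2)
    simp only [eval_mul, eval_pow, eval_sub, eval_X, eval_C, sub_self] at h1
    have h2 := hL.2.sq_nonneg m γ
    have h3 := hL'.2.sq_nonneg m γ
    have h4 := mul_nonneg ha.le h2
    have h5 := mul_nonneg hb.le h3
    have : a * L (X ^ m * (X - C γ) ^ 2) = 0 := by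
      norm_num at h1
      linarith
    exact (mul_eq_zero.1 this).resolve_left ha.ne'
  have hrec : ∀ m, L (X ^ (m + 2)) = 2 * γ * L (X ^ (m + 1)) - γ ^ 2 * L (X ^ m) := fun m => by
    have h1 := hsq m
    rw [show X ^ m * (X - C γ) ^ 2 = X ^ (m + 2) - C (2 * γ) * X ^ (m + 1) + C (γ ^ 2) * X ^ m by
      simp only [map_mul, map_pow, map_ofNat]; ring, map_add, map_sub, ← smul_eq_C_mul,
      ← smul_eq_C_mul, map_smul, map_smul, smul_eq_mul, smul_eq_mul] at h1
    linarith
  have hpos : ∀ m, 0 < L (X ^ m) := fun m => by simpa [walkPoly] using hL.2 m 0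
  have hpos' : ∀ m, 0 < L' (X ^ m) := fun m => by simpa [walkPoly] using hL'.2 m 0
  have hle : ∀ m, a * L (X ^ m) ≤ γ ^ m := fun m => by
    have h1 := hval (X ^ m)
    simp only [eval_pow, eval_X] at h1
    linarith [mul_pos hb (hpos' m)]
  -- The general solution for a double root is γ^m times an affine function of m. Two consecutive
  -- values are carried because the recursion has order two.
  have hform : ∀ m : ℕ, γ * L (X ^ m) = γ ^ m * (γ + m * (L X - γ)) ∧
      γ * L (X ^ (m + 1)) = γ ^ (m + 1) * (γ + (m + 1 : ℕ) * (L X - γ)) := fun m => by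
    induction m with
    | zero => simp [hL.1]
    | succ m ih =>
      refine ⟨ih.2, ?_⟩
      obtain ⟨h1, h2⟩ := ih
      rw [show m + 1 + 1 = m + 2 from rfl, hrec]
      push_cast at h2 ⊢
      linear_combination 2 * γ * h2 - γ ^ 2 * h1
  have hd : L X = γ := by
    by_contra hne
    -- A negative slope contradicts positivity of the moments, a positive one the bound a L(X^m) ≤
    -- γ^m.
    rcases lt_or_gt_of_ne hne with hlt | hlt
    · obtain ⟨m, hm⟩ := exists_nat_gt (γ / (γ - L X))
      rw [div_lt_iff₀ (by linarith)] at hm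
      have h1 := (hform m).1
      have h2 := mul_pos hγ (hpos m)
      rw [h1] at h2
      have := (pos_iff_pos_of_mul_pos h2).1 (pow_pos hγ m)
      linarith
    · obtain ⟨m, hm⟩ := exists_nat_gt (γ / (a * (L X - γ)))
      rw [div_lt_iff₀ (mul_pos ha (by linarith))] at hm
      have h1 := (hform m).1
      have h2 := mul_le_mul_of_nonneg_left (hle m) hγ.le
      rw [mul_left_comm, h1, mul_left_comm, mul_comm γ] at h2
      have h3 := le_of_mul_le_mul_left h2 (pow_pos hγ m)
      nlinarith [mul_pos ha hγ]
  refine functional_ext fun m => ?_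
  have h1 := (hform m).1
  rw [hd, sub_self, mul_zero, add_zero, mul_comm] at h1
  rw [leval_pow]
  exact mul_right_cancel₀ hγ.ne' h1

theorem extremePoints_walkPositive :
    walkPositive.extremePoints ℝ = leval '' Set.Ioc (0 : ℝ) (1 / 4) := by
  refine Set.Subset.antisymm (fun L hL => ?_) ?_
  · obtain ⟨γ, hγ, rfl⟩ := exists_leval_of_extreme hL
    exact ⟨γ, hγ, rfl⟩
  · rintro _ ⟨γ, hγ, rfl⟩
    refine mem_extremePoints.2 ⟨leval_mem_walkPositive hγ, ?_⟩
    rintro L hL L' hL' ⟨a, b, ha, hb, -, h⟩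
    exact ⟨eq_leval_of_convex_combination hL hL' hγ.1 ha hb h,
      eq_leval_of_convex_combination hL' hL hγ.1 hb ha (by rwa [add_comm])⟩

end Functionals

/-! ## Classification of extremal traces -/

open Polynomial in
theorem constr_basisMonomials_pow (u : ℕ → ℝ) (m : ℕ) :
    (basisMonomials ℝ).constr ℝ u (X ^ m) = u m := by
  rw [X_pow_eq_monomial, ← Module.Basis.constr_basis (basisMonomials ℝ) ℝ u m, coe_basisMonomials]

open Polynomial in
/-- The functional on polynomials attached to a trace. -/
def momentFunctional (δ : ℝ) : (TL δ ⊤ →ₗ[ℂ] ℂ) →ₗ[ℝ] (ℝ[X] →ₗ[ℝ] ℝ) where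
  toFun t := (basisMonomials ℝ).constr ℝ fun m => (coeff t (2 * m) m).re
  map_add' s t := functional_ext fun m => by
    simp only [LinearMap.add_apply, constr_basisMonomials_pow, coeff, mul_add, Complex.add_re]
  map_smul' c t := functional_ext fun m => by
    simp only [LinearMap.smul_apply, constr_basisMonomials_pow, coeff, mul_smul_comm,
      Complex.smul_re, RingHom.id_apply]

open Polynomial in
theorem momentFunctional_pow (t : TL δ ⊤ →ₗ[ℂ] ℂ) (m : ℕ) :
    momentFunctional δ t (X ^ m) = (coeff t (2 * m) m).re :=
  constr_basisMonomials_pow _ m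

-- The harmonic relation, solved for c_{n+1,p}, is the recursion of `walkPoly`, so the diagonal
-- coefficients determine all others.
open Polynomial in
theorem momentFunctional_walkPoly (hU : ∀ m, quantumInt δ (m + 1) ≠ 0) {t : TL δ ⊤ →ₗ[ℂ] ℂ}
    (ht : IsTrace t) (k i : ℕ) :
    momentFunctional δ t (X ^ i * walkPoly k) = (coeff t (2 * i + k) i).re := by
  have hc := isHarmonic_coeff hU ht
  induction k using Nat.strong_induction_on generalizing i with
  | _ k ih =>
  match k with
  | 0 => simp [walkPoly, momentFunctional_pow]
  | 1 => rw [← hc.top]; simp [walkPoly, momentFunctional_pow]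
  | k + 2 =>
    have h1 := hc.add (2 * i + k + 1) i (by omega)
    rw [walkPoly, mul_sub, map_sub, ← mul_assoc, ← pow_succ, ih (k + 1) (by omega),
      ih k (by omega), show 2 * i + (k + 1) = 2 * i + k + 1 by ring, h1,
      show 2 * (i + 1) + k = 2 * i + k + 1 + 1 by ring,
      show 2 * i + (k + 2) = 2 * i + k + 1 + 1 by ring]
    simp

/-- The normalized traces with positive coefficients. -/
def positiveTraces (δ : ℝ) : Set (TL δ ⊤ →ₗ[ℂ] ℂ) :=
  {t | IsTrace t ∧ IsNormalized t ∧ IsCoeffPositive t}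

theorem convex_positiveTraces (hU : ∀ m, quantumInt δ (m + 1) ≠ 0) :
    Convex ℝ (positiveTraces δ) := by
  rintro s ⟨h1, h2, h3⟩ t ⟨h1', h2', h3'⟩ a b ha hb hab
  have hst : IsTrace (a • s + b • t) := fun x y => by
    simp only [LinearMap.add_apply, LinearMap.smul_apply, h1 x, h1' x]
  refine ⟨hst, ?_, ?_⟩
  · rw [IsNormalized] at h2 h2' ⊢
    rw [LinearMap.add_apply, LinearMap.smul_apply, LinearMap.smul_apply, h2, h2', ← add_smul, hab,
      one_smul]
  · rw [isCoeffPositive_iff hU h1] at h3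
    rw [isCoeffPositive_iff hU h1'] at h3'
    rw [isCoeffPositive_iff hU hst]
    intro n i hi
    have h4 : coeff (a • s + b • t) n i = a • coeff s n i + b • coeff t n i := by
      simp only [coeff, LinearMap.add_apply, LinearMap.smul_apply, mul_add, mul_smul_comm]
    rw [h4]
    have := convex_Ioi (𝕜 := ℝ) (0 : ℂ) (h3 n i hi) (h3' n i hi) ha hb hab
    exact this

open Polynomial in
theorem exists_trace_of_functional (hU : ∀ m, quantumInt δ (m + 1) ≠ 0) (L : ℝ[X] →ₗ[ℝ] ℝ) :
    ∃ t : TL δ ⊤ →ₗ[ℂ] ℂ, HasCoeffs t fun n i => (L (X ^ i * walkPoly (n - 2 * i)) : ℂ) := by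
  refine IsHarmonic.exists_trace hU ⟨fun p => ?_, fun n p hp => ?_⟩
  · rw [Nat.sub_self, Nat.add_sub_cancel_left]
    rfl
  · obtain ⟨k, rfl⟩ : ∃ k, n = 2 * p + k + 1 := ⟨n - 2 * p - 1, by omega⟩
    rw [show 2 * p + k + 1 - 2 * p = k + 1 by omega,
      show 2 * p + k + 1 + 1 - 2 * p = k + 2 by omega,
      show 2 * p + k + 1 + 1 - 2 * (p + 1) = k by omega, ← Complex.ofReal_add, ← map_add, walkPoly]
    congr 2
    ring

/-- `momentFunctional` keeps only real parts. Nothing is lost on positive traces, whose coefficients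
are real. -/
theorem bijOn_momentFunctional (hU : ∀ m, quantumInt δ (m + 1) ≠ 0) :
    Set.BijOn (momentFunctional δ) (positiveTraces δ) walkPositive := by
  have hwalk : ∀ t ∈ positiveTraces δ, ∀ n i, 2 * i ≤ n → (coeff t n i) =
      (momentFunctional δ t (Polynomial.X ^ i * walkPoly (n - 2 * i)) : ℂ) := by
    rintro t ⟨h1, _, h3⟩ n i hi
    have h4 := (isCoeffPositive_iff hU h1).1 h3 n i hi
    rw [momentFunctional_walkPoly hU h1, Nat.add_sub_cancel' hi]
    exact Complex.ext rfl (Complex.lt_def.1 h4).2.symm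
  refine ⟨?_, ?_, ?_⟩
  · rintro t ⟨h1, h2, h3⟩
    refine ⟨?_, fun i k => ?_⟩
    · have := momentFunctional_pow t 0
      rw [pow_zero, mul_zero, coeff_zero_zero, h2] at this
      exact this
    · rw [momentFunctional_walkPoly hU h1]
      exact (Complex.lt_def.1 ((isCoeffPositive_iff hU h1).1 h3 _ i (by omega))).1
  · intro s hs t ht h
    refine (hasCoeffs_coeff hU hs.1).ext ((hasCoeffs_coeff hU ht.1).congr fun n i hi => ?_)
    rw [hwalk s hs n i hi, hwalk t ht n i hi, h]
  · rintro L ⟨h1, h2⟩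
    obtain ⟨t, ht⟩ := exists_trace_of_functional hU L
    refine ⟨t, ⟨ht.isTrace, ?_, _, ht, fun n i _ => by exact_mod_cast h2 i _⟩, ?_⟩
    · rw [IsNormalized, ← coeff_zero_zero, ← ht.eq_coeff hU (by omega)]
      simp [walkPoly, h1]
    · refine functional_ext fun m => ?_
      rw [momentFunctional_pow, ← ht.eq_coeff hU le_rfl, Nat.sub_self]
      simp [walkPoly]

/-- Convexity of s compensates for f being injective only on s: convex combinations of points of s
stay where injectivity is available. -/
theorem mem_extremePoints_of_bijOn {E F : Type*} [AddCommGroup E] [Module ℝ E] [AddCommGroup F]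
    [Module ℝ F] (f : E →ₗ[ℝ] F) {s : Set E} {t : Set F} (hs : Convex ℝ s) (hf : Set.BijOn f s t)
    {x : E} (hx : x ∈ s) : x ∈ s.extremePoints ℝ ↔ f x ∈ t.extremePoints ℝ := by
  constructor
  · intro h
    refine ⟨hf.mapsTo hx, ?_⟩
    intro y' hy' z' hz' hyz
    obtain ⟨y, hy, rfl⟩ := hf.surjOn hy'
    obtain ⟨z, hz, rfl⟩ := hf.surjOn hz'
    obtain ⟨a, b, ha, hb, hab, h1⟩ := hyz
    rw [← map_smul, ← map_smul, ← map_add] at h1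
    have h2 := hf.injOn (hs hy hz ha.le hb.le hab) hx h1
    rw [h.2 hy hz ⟨a, b, ha, hb, hab, h2⟩]
  · intro h
    refine ⟨hx, ?_⟩
    rintro y hy z hz ⟨a, b, ha, hb, hab, rfl⟩
    refine hf.injOn hy hx (h.2 (hf.mapsTo hy) (hf.mapsTo hz) ⟨a, b, ha, hb, hab, ?_⟩)
    rw [map_add, map_smul, map_smul]

/-- Dividing [k+3] = [2][k+2] − [k+1] by [2]^{k+2} gives the recursion of `walkPoly` at γ. -/
theorem eval_walkPoly_eq {γ : ℝ} {r : ℂ} (h2 : qInt r 2 ≠ 0) (h : (γ : ℂ) = (qInt r 2 ^ 2)⁻¹) :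
    ∀ k, (((walkPoly k).eval γ : ℝ) : ℂ) = qInt r (k + 1) / qInt r 2 ^ k
  | 0 => by simp [walkPoly, qInt]
  | 1 => by simp [walkPoly, h2]
  | k + 2 => by
    have h3 : (walkPoly (k + 2)).eval γ =
        (walkPoly (k + 1)).eval γ - γ * (walkPoly k).eval γ := by simp [walkPoly]
    have h4 : qInt r (k + 2 + 1) = qInt r 2 * qInt r (k + 1 + 1) - qInt r (k + 1) := by
      simp [qInt]
    rw [h3, Complex.ofReal_sub, Complex.ofReal_mul, eval_walkPoly_eq h2 h k,
      eval_walkPoly_eq h2 h (k + 1), h4, h]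
    field_simp
    ring

theorem exists_qInt_two (s : ℂ) : ∃ r : ℂ, r ≠ 0 ∧ qInt r 2 = s := by
  obtain ⟨w, hw⟩ := IsAlgClosed.exists_pow_nat_eq (s ^ 2 - 4) (n := 2) (by norm_num)
  have h1 : ((s + w) / 2) * ((s - w) / 2) = 1 := by linear_combination -hw / 4
  refine ⟨(s + w) / 2, left_ne_zero_of_mul_eq_one h1, ?_⟩
  rw [show qInt ((s + w) / 2) 2 = (s + w) / 2 + ((s + w) / 2)⁻¹ by simp [qInt],
    inv_eq_of_mul_eq_one_right h1]
  ring

theorem extremalsClassified (hU : ∀ m, quantumInt δ (m + 1) ≠ 0) :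
    ExtremalsClassified (positiveTraces δ) := by
  have hbij := bijOn_momentFunctional hU
  have hex : ∀ γ : ℝ, ∃ t : TL δ ⊤ →ₗ[ℂ] ℂ, HasCoeffs t fun n i =>
      (Polynomial.leval γ (Polynomial.X ^ i * walkPoly (n - 2 * i)) : ℂ) := fun γ =>
    exists_trace_of_functional hU _
  choose T hT using hex
  have hTm : ∀ γ, momentFunctional δ (T γ) = Polynomial.leval γ := fun γ =>
    functional_ext fun m => by
      rw [momentFunctional_pow, ← (hT γ).eq_coeff hU le_rfl, Nat.sub_self,
        Complex.ofReal_re, walkPoly, mul_one]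
  have hTS : ∀ γ ∈ Set.Ioc (0 : ℝ) (1 / 4), T γ ∈ positiveTraces δ := fun γ hγ => by
    have h := leval_mem_walkPositive hγ
    refine ⟨(hT γ).isTrace, ?_, _, hT γ, fun n i _ => by exact_mod_cast h.2 i _⟩
    rw [IsNormalized, ← coeff_zero_zero, ← (hT γ).eq_coeff hU (by omega)]
    simp [walkPoly]
  refine ⟨T, ⟨fun γ hγ => ?_, fun γ _ γ' _ h => ?_, fun t ht => ?_⟩, fun γ hγ => ⟨?_, ?_⟩⟩
  · rw [mem_extremePoints_of_bijOn _ (convex_positiveTraces hU) hbij (hTS γ hγ), hTm,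
      extremePoints_walkPositive]
    exact ⟨γ, hγ, rfl⟩
  · have := congrArg (momentFunctional δ) h
    rw [hTm, hTm] at this
    simpa [Polynomial.leval_apply] using LinearMap.congr_fun this Polynomial.X
  · have h1 := ht
    rw [mem_extremePoints_of_bijOn _ (convex_positiveTraces hU) hbij ht.1,
      extremePoints_walkPositive] at h1
    obtain ⟨γ, hγ, h⟩ := h1
    exact ⟨γ, hγ, hbij.injOn (hTS γ hγ) ht.1 (by rw [hTm, h])⟩
  · obtain ⟨r, hr, h⟩ := exists_qInt_two ((Real.sqrt γ)⁻¹ : ℝ)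
    refine ⟨r, hr, ?_⟩
    rw [h, ← Complex.ofReal_pow, ← Complex.ofReal_inv, inv_pow, inv_inv, Real.sq_sqrt hγ.1.le]
  · intro r _ h
    have h2 : qInt r 2 ≠ 0 := by
      intro h0
      rw [h0] at h
      have := hγ.1.ne'
      simp at h
      exact this h
    refine (hT γ).congr fun n i _ => ?_
    simp only [Polynomial.leval_apply, Polynomial.eval_mul, Polynomial.eval_pow,
      Polynomial.eval_X, Complex.ofReal_mul, Complex.ofReal_pow]
    rw [eval_walkPoly_eq h2 h, mul_div_assoc]

/-! ## Positivity with respect to the involution -/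

/-- One direction tests positivity on `cupProj`, whose product with its adjoint is δ^i `cupProj`;
the other is `trace_mul_star`. -/
theorem isStarPositive_iff (hU : ∀ m, quantumInt δ (m + 1) ≠ 0) (hδ : 0 < δ)
    (hr : ∀ m, 0 < ratio δ m) {t : TL δ ⊤ →ₗ[ℂ] ℂ} (ht : IsTrace t) :
    IsStarPositive t ↔ IsCoeffPositive t := by
  have hpow : ∀ i, (0 : ℂ) < (δ : ℂ) ^ i := fun i => pow_pos (by exact_mod_cast hδ) i
  rw [isCoeffPositive_iff hU ht]
  constructor
  · intro h n i hi
    -- `cupProj` must be shown to be nonzero in TL_∞. A trace with positive coefficients detects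
    -- this, and γ = 1/4 is one admissible choice.
    obtain ⟨s, hs⟩ := exists_trace_of_functional hU (Polynomial.leval (1 / 4))
    have h0 : cupProj δ ⊤ i n ≠ 0 := by
      intro h0
      have h1 := hs.eq_coeff hU hi
      rw [coeff, h0, map_zero, mul_zero] at h1
      have h2 := (leval_mem_walkPositive (γ := 1 / 4) ⟨by norm_num, le_rfl⟩).2 i (n - 2 * i)
      exact h2.ne' (by exact_mod_cast h1)
    have h1 := h _ h0
    rw [cupProj_mul_star hU, map_smul, smul_eq_mul] at h1
    have h2 := (pos_iff_pos_of_mul_pos h1).1 (hpow i)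
    exact mul_pos (inv_pos.2 (hpow i)) h2
  · intro h a ha
    obtain ⟨n, -, han⟩ := exists_mem_strands a
    have h1 := trace_mul_star hU hδ hr ht (n := n) (fun p hp => by
      have h2 := mul_pos (hpow p) (h n p hp)
      rwa [coeff, mul_inv_cancel_left₀ (hpow p).ne'] at h2) han
    exact lt_of_le_of_ne h1.1 fun h2 => ha (h1.2 h2.symm)

/-! ### Nonvanishing and positivity of the quantum integers. -/

theorem quantumInt_eq_qInt {q : ℂ} (hδ : (δ : ℂ) = q + q⁻¹) :
    ∀ m, ((quantumInt δ m : ℝ) : ℂ) = qInt q m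
  | 0 => by simp [quantumInt, qInt]
  | 1 => by simp [quantumInt, qInt]
  | m + 2 => by
    rw [quantumInt, qInt, ← hδ, ← quantumInt_eq_qInt hδ m, ← quantumInt_eq_qInt hδ (m + 1)]
    push_cast
    ring

/-- If [m+1] = 0 then q^{m+1} = q^{-(m+1)}, so q would be a root of unity of order dividing 2(m+1).
-/
theorem quantumInt_ne_zero {q : ℂ} (hq : q ≠ 0) (hgen : ∀ k : ℕ, 0 < k → q ^ k ≠ 1)
    (hδ : (δ : ℂ) = q + q⁻¹) (m : ℕ) : quantumInt δ (m + 1) ≠ 0 := by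
  intro h
  have h1 := qInt_mul q hq (m + 1)
  rw [← quantumInt_eq_qInt hδ, h, Complex.ofReal_zero, mul_zero] at h1
  refine hgen (2 * (m + 1)) (by omega) ?_
  rw [two_mul, pow_add]
  nth_rewrite 1 [sub_eq_zero.1 h1.symm]
  rw [← mul_pow, inv_mul_cancel₀ hq, one_pow]

theorem quantumInt_pos (hδ : 2 ≤ δ) (m : ℕ) :
    0 < quantumInt δ (m + 1) ∧ quantumInt δ m ≤ quantumInt δ (m + 1) := by
  induction m with
  | zero => simp [quantumInt]
  | succ m ih =>
    have h : quantumInt δ (m + 1 + 1) = δ * quantumInt δ (m + 1) - quantumInt δ m := rfl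
    have := mul_le_mul_of_nonneg_right hδ ih.1.le
    constructor <;> linarith

end TemperleyLieb

end

theorem mainTheorem5 (q : ℂ) (hq : q ≠ 0) (hgen : ∀ k : ℕ, 0 < k → q ^ k ≠ 1)
    (δ : ℝ) (hδ : (δ : ℂ) = q + q⁻¹) (hδ0 : 0 ≤ δ) :
    (∀ t : TemperleyLieb.TL δ ⊤ →ₗ[ℂ] ℂ, TemperleyLieb.IsTrace t →
      ∃ c : ℕ → ℕ → ℂ, TemperleyLieb.HasCoeffs t c ∧
        ∀ c' : ℕ → ℕ → ℂ, TemperleyLieb.HasCoeffs t c' → ∀ n i, 2 * i ≤ n → c' n i = c n i) ∧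
    TemperleyLieb.ExtremalsClassified
      {t : TemperleyLieb.TL δ ⊤ →ₗ[ℂ] ℂ | TemperleyLieb.IsTrace t ∧
        TemperleyLieb.IsNormalized t ∧ TemperleyLieb.IsCoeffPositive t} ∧
    (2 < δ →
      (∀ t : TemperleyLieb.TL δ ⊤ →ₗ[ℂ] ℂ, TemperleyLieb.IsTrace t →
        (TemperleyLieb.IsStarPositive t ↔ TemperleyLieb.IsCoeffPositive t)) ∧
      TemperleyLieb.ExtremalsClassified
        {t : TemperleyLieb.TL δ ⊤ →ₗ[ℂ] ℂ | TemperleyLieb.IsTrace t ∧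
          TemperleyLieb.IsNormalized t ∧ TemperleyLieb.IsStarPositive t}) := by
  have hU := TemperleyLieb.quantumInt_ne_zero hq hgen hδ
  have hb := TemperleyLieb.extremalsClassified hU
  refine ⟨fun t ht => ⟨_, TemperleyLieb.hasCoeffs_coeff hU ht,
    fun c' hc' n i hi => hc'.eq_coeff hU hi⟩, hb, fun h2 => ?_⟩
  have hiff : ∀ t : TemperleyLieb.TL δ ⊤ →ₗ[ℂ] ℂ, TemperleyLieb.IsTrace t →
      (TemperleyLieb.IsStarPositive t ↔ TemperleyLieb.IsCoeffPositive t) := fun t ht =>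
    TemperleyLieb.isStarPositive_iff hU (by linarith) (fun m => div_pos
      (TemperleyLieb.quantumInt_pos h2.le m).1 (TemperleyLieb.quantumInt_pos h2.le (m + 1)).1) ht
  refine ⟨hiff, ?_⟩
  convert hb using 1
  ext t
  exact and_congr_right fun ht => and_congr_right fun _ => hiff t ht
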